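/- Let $Q$ be a $II_1$ factor with trace $\tau$, and let $L^2(Q)$ be the completion of $Q$ for the inner product given by $\tau$; write $[x]\in L^2(Q)$ for the vector of $x\in Q$. Let $G$ be a subgroup of $\mathrm{Out}(Q)=\mathrm{Aut}(Q)/\mathrm{Inn}(Q)$ generated by two finite subgroups $H$ and $K$. Let $g\mapsto\alpha_g\in\mathrm{Aut}(Q)$ be a choice of representatives of the elements $g\in G$ such that $\alpha|_H$ and $\alpha|_K$ are homomorphisms, and let $u(g_1,g_2)\in\mathcal U(Q)$ $(g_1,g_2\in G)$ be unitaries with $\alpha_{g_1}\alpha_{g_2}=\mathrm{Ad}_{u(g_1,g_2)}\,\alpha_{g_1g_2}$. Put $N=Q^H=\{x\in Q:\alpha_h(x)=x \text{ for all } h\in H\}$. For $g\in G$ let $X_g={}_NL^2(Q_{\alpha_g})_N$ be the $N$-$N$ bimodule with underlying Hilbert space $L^2(Q)$ and actions $n\cdot[x]\cdot m=[n\,x\,\alpha_g(m)]$ for $n,m\in N$, $x\in Q$, and let $\mathcal C_{NN}(X_{g_1},X_{g_2})$ be the space of bounded linear maps $X_{g_1}\to X_{g_2}$ that are left and right $N$-linear.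 **Proposition.** Let $g_1,g_2\in G$. If $Hg_1H\neq Hg_2H$, then $\mathcal C_{NN}(X_{g_1},X_{g_2})=0$. If $Hg_1H=Hg_2H$, then for every pair $(h_1,h_2)\in H\times H$ with $h_1g_1=g_2h_2$ there is a (unique) element of $\mathcal C_{NN}(X_{g_1},X_{g_2})$ such that $$[x]\longmapsto[\alpha_{h_1}(x)\,u(h_1,g_1)\,u(g_2,h_2)^*]\qquad(x\in Q),$$ and these elements, indexed by all such pairs $(h_1,h_2)$, form a basis of $\mathcal C_{NN}(X_{g_1},X_{g_2})$. -/

import Mathlib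

open scoped ComplexOrder InnerProductSpace

/-! ## Type II₁ factors and their standard Hilbert space `L²(Q)` -/

section TypeIIOne

variable {Q : Type*} [CStarAlgebra Q] [PartialOrder Q] [StarOrderedRing Q]

/-- `Q` is a type II₁ factor with trace `τ`: `τ` is a faithful tracial state, the representation of
`Q` on the Hilbert space `L²(Q) = τ.GNS` identifies `Q` with a von Neumann algebra (so that `τ`,
being a vector state there, is normal), `Q` has trivial centre and is infinite dimensional. -/
structure IsTypeIIOneFactor (τ : Q →ₚ[ℂ] ℂ) : Prop where
  map_one : τ 1 = 1
  tracial : ∀ x y : Q, τ (x * y) = τ (y * x)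
  faithful : ∀ x : Q, τ (star x * x) = 0 → x = 0
  isVonNeumann : ∃ 𝓜 : VonNeumannAlgebra τ.GNS,
    (𝓜 : Set (τ.GNS →L[ℂ] τ.GNS)) = Set.range τ.gnsStarAlgHom
  factor : ∀ z : Q, (∀ x : Q, z * x = x * z) → ∃ c : ℂ, z = algebraMap ℂ Q c
  infinite : ¬ FiniteDimensional ℂ Q

/-- The vector `[x]` of `L²(Q)` given by `x : Q`. -/
noncomputable def vec (τ : Q →ₚ[ℂ] ℂ) (x : Q) : τ.GNS := (τ.toPreGNS x : τ.GNS)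

/-- Right multiplication `[x] ↦ [x y]` before completion; it is bounded because `τ` is tracial. -/
noncomputable def rightMulPreGNS {τ : Q →ₚ[ℂ] ℂ} (hτ : ∀ x y : Q, τ (x * y) = τ (y * x)) (y : Q) :
    τ.PreGNS →L[ℂ] τ.PreGNS :=
  LinearMap.mkContinuous
    (τ.toPreGNS.toLinearMap ∘ₗ LinearMap.mulRight ℂ y ∘ₗ τ.ofPreGNS.toLinearMap) ‖y‖ fun x ↦ by
      rw [← sq_le_sq₀ (by positivity) (by positivity), mul_pow, ← RCLike.ofReal_le_ofReal (K := ℂ),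
        RCLike.ofReal_pow, RCLike.ofReal_eq_complex_ofReal, PositiveLinearMap.preGNS_norm_sq]
      have h : τ.ofPreGNS x * (y * star y) * star (τ.ofPreGNS x) ≤
          ‖y‖ ^ 2 • (τ.ofPreGNS x * star (τ.ofPreGNS x)) := by
        rw [sq, ← CStarRing.norm_self_mul_star (x := y)]
        exact CStarAlgebra.star_right_conjugate_le_norm_smul
      have h' := OrderHomClass.mono τ h
      have e1 : τ (star (τ.ofPreGNS x * y) * (τ.ofPreGNS x * y)) =
          τ (τ.ofPreGNS x * (y * star y) * star (τ.ofPreGNS x)) := by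
        rw [hτ, star_mul]; simp only [mul_assoc]
      have e2 : ((‖x‖ : ℂ) ^ 2) = τ (τ.ofPreGNS x * star (τ.ofPreGNS x)) := by
        rw [hτ, ← PositiveLinearMap.preGNS_norm_sq]
      have e3 : τ (‖y‖ ^ 2 • (τ.ofPreGNS x * star (τ.ofPreGNS x))) =
          ((‖y‖ ^ 2 : ℝ) : ℂ) * τ (τ.ofPreGNS x * star (τ.ofPreGNS x)) := by
        rw [← Complex.coe_smul, map_smul, smul_eq_mul]
      simp only [LinearMap.comp_apply, LinearEquiv.coe_coe, LinearMap.mulRight_apply,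
        PositiveLinearMap.ofPreGNS_toPreGNS]
      rw [e1]
      refine h'.trans (le_of_eq ?_)
      rw [e3, ← e2]
      simp

/-- The right multiplication operator `ξ ↦ ξ · y` on `L²(Q)`: the bounded operator with
`[x] ↦ [x y]`. -/
noncomputable def rightMul {τ : Q →ₚ[ℂ] ℂ} (hτ : ∀ x y : Q, τ (x * y) = τ (y * x)) (y : Q) :
    τ.GNS →L[ℂ] τ.GNS :=
  (rightMulPreGNS hτ y).completion

theorem rightMul_vec {τ : Q →ₚ[ℂ] ℂ} (hτ : ∀ x y : Q, τ (x * y) = τ (y * x)) (y x : Q) :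
    rightMul hτ y (vec τ x) = vec τ (x * y) := by
  simp [rightMul, vec, rightMulPreGNS]

theorem leftMul_vec (τ : Q →ₚ[ℂ] ℂ) (y x : Q) :
    τ.gnsStarAlgHom y (vec τ x) = vec τ (y * x) := by
  simp [vec]

theorem dense_range_vec (τ : Q →ₚ[ℂ] ℂ) : DenseRange (vec τ) :=
  UniformSpace.Completion.denseRange_coe (α := τ.PreGNS)

theorem adjoint_rightMul {τ : Q →ₚ[ℂ] ℂ} (hτ : ∀ x y : Q, τ (x * y) = τ (y * x)) (y : Q) :
    rightMul hτ (star y) = ContinuousLinearMap.adjoint (rightMul hτ y) := by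
  refine (ContinuousLinearMap.eq_adjoint_iff _ _).mpr fun ξ η ↦ ?_
  induction ξ, η using UniformSpace.Completion.induction_on₂ with
  | hp => apply isClosed_eq <;> fun_prop
  | ih a b =>
    simp only [rightMul, ContinuousLinearMap.completion_apply_coe,
      UniformSpace.Completion.inner_coe, PositiveLinearMap.preGNS_inner_def, rightMulPreGNS,
      LinearMap.mkContinuous_apply, LinearMap.comp_apply, LinearEquiv.coe_coe,
      LinearMap.mulRight_apply, PositiveLinearMap.ofPreGNS_toPreGNS, star_mul, star_star]
    rw [mul_assoc, hτ, mul_assoc]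

theorem ext_vec {τ : Q →ₚ[ℂ] ℂ} {S T : τ.GNS →L[ℂ] τ.GNS}
    (h : ∀ x : Q, S (vec τ x) = T (vec τ x)) : S = T :=
  ContinuousLinearMap.ext fun ξ ↦ congrFun
    ((dense_range_vec τ).equalizer S.continuous T.continuous (funext h)) ξ

theorem vec_add (τ : Q →ₚ[ℂ] ℂ) (x y : Q) : vec τ (x + y) = vec τ x + vec τ y := by
  simp [vec, UniformSpace.Completion.coe_add]

theorem vec_smul (τ : Q →ₚ[ℂ] ℂ) (c : ℂ) (x : Q) : vec τ (c • x) = c • vec τ x := by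
  simp [vec, UniformSpace.Completion.coe_smul]

/-- The right action of `Q` on `L²(Q)`, as a representation of the opposite algebra. -/
noncomputable def rightRep {τ : Q →ₚ[ℂ] ℂ} (hτ : ∀ x y : Q, τ (x * y) = τ (y * x)) :
    Qᵐᵒᵖ →⋆ₐ[ℂ] (τ.GNS →L[ℂ] τ.GNS) where
  toFun y := rightMul hτ y.unop
  map_one' := ext_vec fun x ↦ by simp [rightMul_vec]
  map_mul' a b := ext_vec fun x ↦ by simp [rightMul_vec, mul_assoc]
  map_zero' := ext_vec fun x ↦ by
    rw [MulOpposite.unop_zero, rightMul_vec, mul_zero]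
    exact UniformSpace.Completion.coe_zero
  map_add' a b := ext_vec fun x ↦ by simp [rightMul_vec, mul_add, vec_add]
  commutes' c := ext_vec fun x ↦ by
    simp [rightMul_vec, Algebra.algebraMap_eq_smul_one, vec_smul]
  map_star' a := adjoint_rightMul hτ a.unop

end TypeIIOne

/-! ## Bimodules and intertwiners -/

section Bimodule

/-- An `A`-`A` bimodule structure on the Hilbert space `𝓗`: commuting *-representations of `A`
(left action) and of its opposite (right action). -/
structure HilbertBimodule (A : Type*) [Ring A] [StarRing A] [Algebra ℂ A]
    (𝓗 : Type*) [NormedAddCommGroup 𝓗] [InnerProductSpace ℂ 𝓗] [CompleteSpace 𝓗] where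
  left : A →⋆ₐ[ℂ] (𝓗 →L[ℂ] 𝓗)
  right : Aᵐᵒᵖ →⋆ₐ[ℂ] (𝓗 →L[ℂ] 𝓗)
  commute : ∀ (a : A) (b : Aᵐᵒᵖ), Commute (left a) (right b)

variable {A : Type*} [Ring A] [StarRing A] [Algebra ℂ A]
  {𝓗 : Type*} [NormedAddCommGroup 𝓗] [InnerProductSpace ℂ 𝓗] [CompleteSpace 𝓗]
  {𝓚 : Type*} [NormedAddCommGroup 𝓚] [InnerProductSpace ℂ 𝓚] [CompleteSpace 𝓚]

/-- The space of morphisms of bimodules: bounded operators that are left and right `A`-linear. -/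
def HilbertBimodule.Hom (X : HilbertBimodule A 𝓗) (Y : HilbertBimodule A 𝓚) :
    Submodule ℂ (𝓗 →L[ℂ] 𝓚) where
  carrier := {T | (∀ (a : A) (ξ : 𝓗), T (X.left a ξ) = Y.left a (T ξ)) ∧
    ∀ (a : A) (ξ : 𝓗), T (X.right (MulOpposite.op a) ξ) = Y.right (MulOpposite.op a) (T ξ)}
  zero_mem' := by simp
  add_mem' hS hT := by
    constructor
    · intro a ξ; simp [hS.1, hT.1]
    · intro a ξ; simp [hS.2, hT.2]
  smul_mem' c T hT := by
    constructor
    · intro a ξ; simp [hT.1]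
    · intro a ξ; simp [hT.2]

end Bimodule

/-! ## Outer automorphisms -/

section Out

/-- The subgroup `Inn(Q)` of inner automorphisms `x ↦ u x u*`, `u` unitary, of `Aut(Q)`. -/
def Inn (Q : Type*) [CStarAlgebra Q] : Subgroup (Q ≃⋆ₐ[ℂ] Q) :=
  (Unitary.conjStarAlgAut ℂ Q).range

instance Inn.normal (Q : Type*) [CStarAlgebra Q] : (Inn Q).Normal where
  conj_mem := by
    rintro _ ⟨u, rfl⟩ θ
    refine ⟨⟨θ u, ?_⟩, ?_⟩
    · rw [Unitary.mem_iff, ← map_star, ← map_mul, ← map_mul]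
      simp
    · ext x
      have hx : θ (θ⁻¹ x) = x := congrArg (fun f : Q ≃⋆ₐ[ℂ] Q ↦ f x) (mul_inv_cancel θ)
      simp [Unitary.conjStarAlgAut_apply, map_mul, map_star, hx]

/-- The outer automorphism group `Out(Q) = Aut(Q) / Inn(Q)`. -/
abbrev Out (Q : Type*) [CStarAlgebra Q] := (Q ≃⋆ₐ[ℂ] Q) ⧸ Inn Q

end Out

/-! ## The Bisch–Haagerup setting -/

section BischHaagerup

/-- The data of the Bisch–Haagerup setting over `Q`: a group `G` of outer automorphisms of `Q`
generated by finite subgroups `H` and `K`, automorphisms `α g` representing the elements of `G`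
such that `α` restricts to an action of `H` and to an action of `K` (these actions are outer since
`G` embeds in `Out(Q)`), and unitaries `u g₁ g₂` of `Q` with
`α g₁ ∘ α g₂ = Ad (u g₁ g₂) ∘ α (g₁ g₂)`. -/
structure BischHaagerupSetting (Q : Type*) [CStarAlgebra Q] (G : Type*) [Group G] where
  χ : G →* Out Q
  χ_injective : Function.Injective χ
  H : Subgroup G
  K : Subgroup G
  finite_H : Finite H
  finite_K : Finite K
  generate : H ⊔ K = ⊤
  α : G → (Q ≃⋆ₐ[ℂ] Q)
  mk_α : ∀ g : G, (QuotientGroup.mk (α g) : Out Q) = χ g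
  α_mul_H : ∀ h ∈ H, ∀ h' ∈ H, α (h * h') = α h * α h'
  α_mul_K : ∀ k ∈ K, ∀ k' ∈ K, α (k * k') = α k * α k'
  u : G → G → unitary Q
  α_mul : ∀ g₁ g₂ : G,
    α g₁ * α g₂ = Unitary.conjStarAlgAut ℂ Q (u g₁ g₂) * α (g₁ * g₂)

namespace BischHaagerupSetting

variable {Q : Type*} [CStarAlgebra Q] {G : Type*} [Group G]

/-- The fixed-point algebra `N = Q^H`. -/
def N (S : BischHaagerupSetting Q G) : StarSubalgebra ℂ Q where
  carrier := {x | ∀ h ∈ S.H, S.α h x = x}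
  mul_mem' ha hb h hh := by rw [map_mul, ha h hh, hb h hh]
  one_mem' h _ := map_one _
  add_mem' ha hb h hh := by rw [map_add, ha h hh, hb h hh]
  zero_mem' h _ := map_zero _
  algebraMap_mem' c h _ := by
    rw [Algebra.algebraMap_eq_smul_one, map_smul, map_one]
  star_mem' ha h hh := by rw [map_star, ha h hh]

/-- The `N`-`N` bimodule `X_g = L²(Q_{α_g})`: the Hilbert space `L²(Q)` with left action
`n · [x] = [n x]` and twisted right action `[x] · n = [x α_g(n)]`. -/
noncomputable def X [PartialOrder Q] [StarOrderedRing Q] (S : BischHaagerupSetting Q G)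
    {τ : Q →ₚ[ℂ] ℂ} (hτ : IsTypeIIOneFactor τ) (g : G) : HilbertBimodule S.N τ.GNS where
  left := τ.gnsStarAlgHom.comp S.N.subtype
  right :=
    { toFun := fun n ↦ rightRep hτ.tracial (MulOpposite.op (S.α g (n.unop : Q)))
      map_one' := by simp
      map_mul' := fun a b ↦ by simp
      map_zero' := by simp
      map_add' := fun a b ↦ by simp
      commutes' := fun c ↦ by
        have h : ((algebraMap ℂ (S.N)ᵐᵒᵖ c).unop : Q) = c • (1 : Q) := by
          simp [Algebra.algebraMap_eq_smul_one]
        rw [h, map_smul, map_one, MulOpposite.op_smul, MulOpposite.op_one, map_smul, map_one,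
          Algebra.algebraMap_eq_smul_one]
      map_star' := fun a ↦ by
        rw [← map_star (rightRep hτ.tracial)]
        simp [map_star] }
  commute a b := ext_vec fun x ↦ by
    change τ.gnsStarAlgHom (a : Q) (rightMul hτ.tracial (S.α g (b.unop : Q)) (vec τ x)) =
      rightMul hτ.tracial (S.α g (b.unop : Q)) (τ.gnsStarAlgHom (a : Q) (vec τ x))
    rw [rightMul_vec, leftMul_vec, leftMul_vec, rightMul_vec, mul_assoc]

theorem X_left_vec [PartialOrder Q] [StarOrderedRing Q] (S : BischHaagerupSetting Q G)
    {τ : Q →ₚ[ℂ] ℂ} (hτ : IsTypeIIOneFactor τ) (g : G) (n : S.N) (x : Q) :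
    (S.X hτ g).left n (vec τ x) = vec τ ((n : Q) * x) :=
  leftMul_vec τ (n : Q) x

theorem X_right_vec [PartialOrder Q] [StarOrderedRing Q] (S : BischHaagerupSetting Q G)
    {τ : Q →ₚ[ℂ] ℂ} (hτ : IsTypeIIOneFactor τ) (g : G) (n : S.N) (x : Q) :
    (S.X hτ g).right (MulOpposite.op n) (vec τ x) = vec τ (x * S.α g (n : Q)) :=
  rightMul_vec hτ.tracial (S.α g (n : Q)) x

end BischHaagerupSetting

end BischHaagerup

open Filter Topology

/-! ### `L²(Q)` as the standard form: commutation theorem and bounded vectors. -/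

section StandardForm

variable {Q : Type*} [CStarAlgebra Q] [PartialOrder Q] [StarOrderedRing Q] {τ : Q →ₚ[ℂ] ℂ}

/-! The heart is a description of the commutant of the left action of `N = Q^H` on `L²(Q)`: every
bounded left `N`-linear `T` has the form `[x] ↦ [∑ α_h(x) q_h]` with `q_h ∈ Q` (`exists_coeff`).
Automorphisms that are distinct in `Out(Q)` are linearly independent over `Q`
(`eq_zero_of_forall_sum_eq_zero`), so right `N`-linearity of `T` can be read off coefficientwise:
`α_h(α_{g₁}(n)) q_h = q_h α_{g₂}(n)` for `n ∈ N`.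

Such a relation on `N` improves to one on `Q`. If `a ≠ 0` and `n a = a β(n)` on `N`, then `[x] ↦ [a
β(x)]` is left `N`-linear; expanding it by `exists_coeff` and averaging shows that `a` intertwines
some `α_k`, `k ∈ H`, with `β` on all of `Q` (`exists_intertwiner`). Since `Q` is a factor, a nonzero
intertwiner of two automorphisms is a multiple of a unitary, so their classes in `Out(Q)` agree. As
`G` embeds in `Out(Q)`, a nonzero `q_h` forces `h g₁ = g₂ k` for some `k ∈ H`, and then `q_h` is a
scalar multiple of `u(h, g₁) u(g₂, k)*` (`coeff_eq_zero_or`). This gives both vanishing and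
spanning; independence of the basis elements is independence of the `α_h`.

The analytic tool is averaging over the unitary group (`exists_average`): convex combinations of
`θ(u) x σ(u)*` converge in `L²(Q)` to an intertwiner of `θ` and `σ`, which is zero when these differ
in `Out(Q)`. Automorphisms act boundedly on `L²(Q)` because they preserve the trace (`trace_map`).
-/

theorem vec_zero (τ : Q →ₚ[ℂ] ℂ) : vec τ 0 = 0 := by
  simpa using vec_smul τ 0 0

/-- The map `x ↦ [x]` as a linear map. -/
noncomputable def vecₗ (τ : Q →ₚ[ℂ] ℂ) : Q →ₗ[ℂ] τ.GNS where
  toFun := vec τ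
  map_add' := vec_add τ
  map_smul' := vec_smul τ

theorem vec_sub (τ : Q →ₚ[ℂ] ℂ) (x y : Q) : vec τ (x - y) = vec τ x - vec τ y :=
  map_sub (vecₗ τ) x y

theorem vec_sum (τ : Q →ₚ[ℂ] ℂ) {ι : Type*} (s : Finset ι) (f : ι → Q) :
    vec τ (∑ i ∈ s, f i) = ∑ i ∈ s, vec τ (f i) :=
  map_sum (vecₗ τ) f s

theorem inner_vec (x y : Q) : ⟪vec τ x, vec τ y⟫_ℂ = τ (star x * y) := by
  simp [vec, UniformSpace.Completion.inner_coe, PositiveLinearMap.preGNS_inner_def]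

theorem norm_vec_sq (x : Q) : (((‖vec τ x‖ ^ 2 : ℝ)) : ℂ) = τ (star x * x) := by
  rw [← inner_vec, inner_self_eq_norm_sq_to_K]
  simp

theorem norm_vec_sq' (x : Q) : ‖vec τ x‖ ^ 2 = (τ (star x * x)).re := by
  rw [← norm_vec_sq, Complex.ofReal_re]

theorem norm_left_apply_le (a : Q) (ξ : τ.GNS) : ‖τ.gnsStarAlgHom a ξ‖ ≤ ‖a‖ * ‖ξ‖ :=
  (ContinuousLinearMap.le_opNorm _ _).trans
    (mul_le_mul_of_nonneg_right (NonUnitalStarAlgHom.norm_apply_le τ.gnsStarAlgHom a)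
      (norm_nonneg _))

/-- A linear map on `Q` that is bounded for the `L²`-norm extends to `L²(Q)`. -/
theorem exists_extension (f : Q →ₗ[ℂ] τ.GNS) (C : ℝ) (h : ∀ x, ‖f x‖ ≤ C * ‖vec τ x‖) :
    ∃ T : τ.GNS →L[ℂ] τ.GNS, ∀ x, T (vec τ x) = f x := by
  let f' : τ.PreGNS →L[ℂ] τ.GNS :=
    LinearMap.mkContinuous (f ∘ₗ τ.ofPreGNS.toLinearMap) C fun x ↦ by
      have := h (τ.ofPreGNS x)
      simpa [vec] using this
  refine ⟨f'.extend (UniformSpace.Completion.toComplL (𝕜 := ℂ) (E := τ.PreGNS)), fun x ↦ ?_⟩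
  have := ContinuousLinearMap.extend_eq (f := f')
    (e := UniformSpace.Completion.toComplL (𝕜 := ℂ) (E := τ.PreGNS))
    UniformSpace.Completion.denseRange_coe
    (UniformSpace.Completion.isUniformInducing_coe _) (τ.toPreGNS x)
  exact this.trans (by simp [f'])

@[elab_as_elim] theorem induction_vec {p : τ.GNS → Prop} (ξ : τ.GNS) (hp : IsClosed {ξ | p ξ})
    (h : ∀ x, p (vec τ x)) : p ξ :=
  isClosed_property (dense_range_vec τ) hp h ξ

@[elab_as_elim] theorem induction_vec₂ {p : τ.GNS → τ.GNS → Prop} (ξ η : τ.GNS)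
    (hp : IsClosed {z : τ.GNS × τ.GNS | p z.1 z.2})
    (h : ∀ x y, p (vec τ x) (vec τ y)) : p ξ η :=
  isClosed_property2 (dense_range_vec τ) hp h ξ η

theorem eq_of_forall_inner_vec {ξ η : τ.GNS} (h : ∀ y, ⟪vec τ y, ξ⟫_ℂ = ⟪vec τ y, η⟫_ℂ) :
    ξ = η := by
  refine ext_inner_left ℂ fun ζ ↦ ?_
  exact induction_vec ζ (by apply isClosed_eq <;> fun_prop) h

namespace IsTypeIIOneFactor

theorem vec_injective (hτ : IsTypeIIOneFactor τ) : Function.Injective (vec τ) := by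
  refine (injective_iff_map_eq_zero (vecₗ τ)).mpr fun x hx ↦ hτ.faithful x ?_
  rw [← norm_vec_sq, show vec τ x = 0 from hx]
  simp

theorem norm_vec_one (hτ : IsTypeIIOneFactor τ) : ‖vec τ 1‖ = 1 := by
  have := norm_vec_sq' (τ := τ) 1
  rw [star_one, one_mul, hτ.map_one, Complex.one_re] at this
  exact (pow_eq_one_iff_of_nonneg (norm_nonneg _) two_ne_zero).mp this

theorem nontrivial (hτ : IsTypeIIOneFactor τ) : Nontrivial Q :=
  ⟨1, 0, fun h ↦ by simpa [h] using hτ.map_one⟩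

theorem norm_vec_star (hτ : IsTypeIIOneFactor τ) (x : Q) : ‖vec τ (star x)‖ = ‖vec τ x‖ := by
  rw [← sq_eq_sq₀ (norm_nonneg _) (norm_nonneg _), norm_vec_sq', norm_vec_sq', star_star,
    hτ.tracial]

theorem norm_vec_mul_le (_hτ : IsTypeIIOneFactor τ) (x y : Q) :
    ‖vec τ (x * y)‖ ≤ ‖x‖ * ‖vec τ y‖ := by
  rw [← leftMul_vec]
  exact norm_left_apply_le _ _

theorem norm_vec_mul_le' (hτ : IsTypeIIOneFactor τ) (x y : Q) :
    ‖vec τ (x * y)‖ ≤ ‖vec τ x‖ * ‖y‖ := by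
  rw [← hτ.norm_vec_star, star_mul, mul_comm, ← hτ.norm_vec_star x, ← norm_star y]
  exact hτ.norm_vec_mul_le _ _

theorem norm_vec_le (hτ : IsTypeIIOneFactor τ) (x : Q) : ‖vec τ x‖ ≤ ‖x‖ := by
  simpa [hτ.norm_vec_one] using hτ.norm_vec_mul_le x 1

theorem norm_vec_unitary_mul (_hτ : IsTypeIIOneFactor τ) (u : unitary Q) (x : Q) :
    ‖vec τ ((u : Q) * x)‖ = ‖vec τ x‖ := by
  rw [← sq_eq_sq₀ (norm_nonneg _) (norm_nonneg _), norm_vec_sq', norm_vec_sq', star_mul,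
    mul_assoc, ← mul_assoc (star (u : Q)), Unitary.coe_star_mul_self, one_mul]

theorem rightMul_add (hτ : IsTypeIIOneFactor τ) (x y : Q) :
    rightMul hτ.tracial (x + y) = rightMul hτ.tracial x + rightMul hτ.tracial y :=
  map_add (rightRep hτ.tracial) (MulOpposite.op x) (MulOpposite.op y)

theorem rightMul_smul (hτ : IsTypeIIOneFactor τ) (c : ℂ) (x : Q) :
    rightMul hτ.tracial (c • x) = c • rightMul hτ.tracial x :=
  map_smul (rightRep hτ.tracial) c (MulOpposite.op x)

set_option linter.unusedVariables false in
/-- The modular conjugation of `L²(Q)`, i.e. the isometric map with `[x] ↦ [x*]`. -/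
noncomputable def conj (hτ : IsTypeIIOneFactor τ) : τ.GNS → τ.GNS :=
  UniformSpace.Completion.map fun x : τ.PreGNS ↦ τ.toPreGNS (star (τ.ofPreGNS x))

theorem isometry_star_preGNS (hτ : IsTypeIIOneFactor τ) :
    Isometry fun x : τ.PreGNS ↦ τ.toPreGNS (star (τ.ofPreGNS x)) := by
  refine Isometry.of_dist_eq fun x y ↦ ?_
  have h := hτ.norm_vec_star (τ.ofPreGNS x - τ.ofPreGNS y)
  rw [dist_eq_norm, dist_eq_norm]
  simpa [vec] using h

theorem isometry_conj (hτ : IsTypeIIOneFactor τ) : Isometry hτ.conj :=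
  hτ.isometry_star_preGNS.completion_map

theorem conj_vec (hτ : IsTypeIIOneFactor τ) (x : Q) : hτ.conj (vec τ x) = vec τ (star x) := by
  simp only [conj, vec]
  rw [UniformSpace.Completion.map_coe hτ.isometry_star_preGNS.uniformContinuous]
  simp

@[fun_prop] theorem continuous_conj (hτ : IsTypeIIOneFactor τ) : Continuous hτ.conj :=
  hτ.isometry_conj.continuous

theorem norm_conj (hτ : IsTypeIIOneFactor τ) (ξ : τ.GNS) : ‖hτ.conj ξ‖ = ‖ξ‖ := by
  refine induction_vec ξ (by apply isClosed_eq <;> fun_prop) fun x ↦ ?_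
  rw [hτ.conj_vec, hτ.norm_vec_star]

theorem conj_conj (hτ : IsTypeIIOneFactor τ) (ξ : τ.GNS) : hτ.conj (hτ.conj ξ) = ξ := by
  refine induction_vec ξ (by apply isClosed_eq <;> fun_prop) fun x ↦ ?_
  rw [hτ.conj_vec, hτ.conj_vec, star_star]

theorem inner_conj (hτ : IsTypeIIOneFactor τ) (ξ η : τ.GNS) :
    ⟪hτ.conj ξ, η⟫_ℂ = ⟪hτ.conj η, ξ⟫_ℂ := by
  refine induction_vec₂ ξ η (by apply isClosed_eq <;> fun_prop) fun x y ↦ ?_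
  rw [hτ.conj_vec, hτ.conj_vec, inner_vec, inner_vec, star_star, star_star, hτ.tracial]

theorem rightMul_conj (hτ : IsTypeIIOneFactor τ) (y : Q) (ξ : τ.GNS) :
    rightMul hτ.tracial y (hτ.conj ξ) = hτ.conj (τ.gnsStarAlgHom (star y) ξ) := by
  refine induction_vec ξ (by apply isClosed_eq <;> fun_prop) fun x ↦ ?_
  rw [hτ.conj_vec, rightMul_vec, leftMul_vec, hτ.conj_vec, star_mul, star_star]

theorem adjoint_left_comm {S : τ.GNS →L[ℂ] τ.GNS}
    (hS : ∀ (a : Q) (ξ : τ.GNS), S (τ.gnsStarAlgHom a ξ) = τ.gnsStarAlgHom a (S ξ))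
    (a : Q) (ξ : τ.GNS) :
    ContinuousLinearMap.adjoint S (τ.gnsStarAlgHom a ξ) =
      τ.gnsStarAlgHom a (ContinuousLinearMap.adjoint S ξ) := by
  have e : τ.gnsStarAlgHom a = ContinuousLinearMap.adjoint (τ.gnsStarAlgHom (star a)) := by
    rw [map_star, ContinuousLinearMap.star_eq_adjoint, ContinuousLinearMap.adjoint_adjoint]
  refine ext_inner_left ℂ fun ζ ↦ ?_
  rw [e, ContinuousLinearMap.adjoint_inner_right, ContinuousLinearMap.adjoint_inner_right,
    ContinuousLinearMap.adjoint_inner_right, ContinuousLinearMap.adjoint_inner_right, hS]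

theorem adjoint_right_comm (hτ : IsTypeIIOneFactor τ) {T : τ.GNS →L[ℂ] τ.GNS}
    (hT : ∀ (a : Q) (ξ : τ.GNS), T (rightMul hτ.tracial a ξ) = rightMul hτ.tracial a (T ξ))
    (a : Q) (ξ : τ.GNS) :
    ContinuousLinearMap.adjoint T (rightMul hτ.tracial a ξ) =
      rightMul hτ.tracial a (ContinuousLinearMap.adjoint T ξ) := by
  have e : rightMul hτ.tracial a = ContinuousLinearMap.adjoint (rightMul hτ.tracial (star a)) := by
    rw [← adjoint_rightMul, star_star]
  refine ext_inner_left ℂ fun ζ ↦ ?_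
  rw [e, ContinuousLinearMap.adjoint_inner_right, ContinuousLinearMap.adjoint_inner_right,
    ContinuousLinearMap.adjoint_inner_right, ContinuousLinearMap.adjoint_inner_right, hT]

/-- Pair with `[y]` and move the multiplication by `y` to the other side. The disjunction serves the
two kinds of operators in the commutation theorem, those commuting with the left action and those
commuting with the right action. -/
theorem adjoint_apply_vec_one (hτ : IsTypeIIOneFactor τ) {S : τ.GNS →L[ℂ] τ.GNS}
    (hS : ∀ x : Q, S (vec τ x) = τ.gnsStarAlgHom x (S (vec τ 1)) ∨
      S (vec τ x) = rightMul hτ.tracial x (S (vec τ 1))) :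
    ContinuousLinearMap.adjoint S (vec τ 1) = hτ.conj (S (vec τ 1)) := by
  refine eq_of_forall_inner_vec fun y ↦ ?_
  rw [ContinuousLinearMap.adjoint_inner_right, ← inner_conj_symm, ← inner_conj_symm _ (hτ.conj _),
    hτ.inner_conj, hτ.conj_vec]
  congr 1
  rcases hS y with h | h
  · rw [h, show vec τ (star y) = τ.gnsStarAlgHom (star y) (vec τ 1) by
      rw [leftMul_vec, mul_one], map_star,
      ContinuousLinearMap.star_eq_adjoint, ContinuousLinearMap.adjoint_inner_left]
  · rw [h, show vec τ (star y) = rightMul hτ.tracial (star y) (vec τ 1) by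
      rw [rightMul_vec, one_mul],
      adjoint_rightMul, ContinuousLinearMap.adjoint_inner_left]

/-- The commutant of the right action of `Q` on `L²(Q)` is the left action of `Q`. -/
theorem exists_eq_left (hτ : IsTypeIIOneFactor τ) {T : τ.GNS →L[ℂ] τ.GNS}
    (hT : ∀ (a : Q) (ξ : τ.GNS), T (rightMul hτ.tracial a ξ) = rightMul hτ.tracial a (T ξ)) :
    ∃ q : Q, T = τ.gnsStarAlgHom q := by
  obtain ⟨𝓜, h𝓜⟩ := hτ.isVonNeumann
  have hT1 (x : Q) : T (vec τ x) = rightMul hτ.tracial x (T (vec τ 1)) := by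
    rw [← hT, rightMul_vec, one_mul]
  -- By the bicommutant theorem it is enough that `T` commutes with every `S` commuting with the
  -- left action. Both operators are determined by their values at `[1]`, and so are their adjoints.
  have key : T ∈ Set.centralizer (Set.centralizer (𝓜 : Set (τ.GNS →L[ℂ] τ.GNS))) := by
    intro S hS
    have hS' (a : Q) (ξ : τ.GNS) : S (τ.gnsStarAlgHom a ξ) = τ.gnsStarAlgHom a (S ξ) := by
      have := hS (τ.gnsStarAlgHom a) (by rw [h𝓜]; exact ⟨a, rfl⟩)
      exact (congrArg (fun A : τ.GNS →L[ℂ] τ.GNS ↦ A ξ) this).symm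
    have hS1 (x : Q) : S (vec τ x) = τ.gnsStarAlgHom x (S (vec τ 1)) := by
      rw [← hS', leftMul_vec, mul_one]
    refine ext_vec fun x ↦ eq_of_forall_inner_vec fun y ↦ ?_
    change ⟪vec τ y, S (T (vec τ x))⟫_ℂ = ⟪vec τ y, T (S (vec τ x))⟫_ℂ
    rw [← ContinuousLinearMap.adjoint_inner_left, ← ContinuousLinearMap.adjoint_inner_left T _ (vec τ y),
      show ContinuousLinearMap.adjoint S (vec τ y) = τ.gnsStarAlgHom y (hτ.conj (S (vec τ 1))) by
        rw [← hτ.adjoint_apply_vec_one fun x ↦ .inl (hS1 x), ← adjoint_left_comm hS', leftMul_vec,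
          mul_one],
      show ContinuousLinearMap.adjoint T (vec τ y) =
          rightMul hτ.tracial y (hτ.conj (T (vec τ 1))) by
        rw [← hτ.adjoint_apply_vec_one fun x ↦ .inr (hT1 x), ← hτ.adjoint_right_comm hT,
          rightMul_vec, one_mul], hT1, hS1 x]
    -- The two matrix coefficients are now continuous expressions in arbitrary vectors `ξ`, `η`; on
    -- the dense subspace `Q` they agree by traciality.
    generalize S (vec τ 1) = η
    generalize T (vec τ 1) = ξ
    refine induction_vec₂ ξ η (by apply isClosed_eq <;> fun_prop) fun a b ↦ ?_
    rw [hτ.conj_vec, hτ.conj_vec, leftMul_vec, leftMul_vec, rightMul_vec, rightMul_vec, inner_vec,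
      inner_vec, star_mul, star_mul, star_star, star_star, mul_assoc b, hτ.tracial b]
    simp only [mul_assoc]
  rw [𝓜.centralizer_centralizer, h𝓜] at key
  obtain ⟨q, hq⟩ := key
  exact ⟨q, hq.symm⟩

/-- Left bounded vectors of `L²(Q)` come from `Q`. -/
theorem exists_eq_vec_of_right (hτ : IsTypeIIOneFactor τ) {ξ : τ.GNS} (C : ℝ)
    (h : ∀ y, ‖rightMul hτ.tracial y ξ‖ ≤ C * ‖vec τ y‖) : ∃ q, ξ = vec τ q := by
  -- The bound makes `[y] ↦ ξ · y` a bounded operator; it commutes with the right action, hence is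
  -- left multiplication by some `q`, and evaluation at `[1]` gives `ξ = [q]`.
  obtain ⟨T, hT⟩ := exists_extension
    ({ toFun := fun y ↦ rightMul hτ.tracial y ξ
       map_add' := fun x y ↦ by rw [hτ.rightMul_add]; rfl
       map_smul' := fun c x ↦ by rw [hτ.rightMul_smul]; rfl } : Q →ₗ[ℂ] τ.GNS) C h
  have hT (x : Q) : T (vec τ x) = rightMul hτ.tracial x ξ := hT x
  obtain ⟨q, hq⟩ := hτ.exists_eq_left (T := T) fun a η ↦ by
    refine induction_vec η (by apply isClosed_eq <;> fun_prop) fun x ↦ ?_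
    rw [rightMul_vec, hT, hT]
    refine induction_vec ξ (by apply isClosed_eq <;> fun_prop) fun z ↦ ?_
    simp only [rightMul_vec, mul_assoc]
  refine ⟨q, ?_⟩
  have h1 := hT 1
  rw [hq, leftMul_vec, mul_one] at h1
  rw [h1]
  refine induction_vec ξ (by apply isClosed_eq <;> fun_prop) fun z ↦ ?_
  rw [rightMul_vec, mul_one]

/-- Right bounded vectors of `L²(Q)` come from `Q`. -/
theorem exists_eq_vec_of_left (hτ : IsTypeIIOneFactor τ) {ξ : τ.GNS} (C : ℝ)
    (h : ∀ y, ‖τ.gnsStarAlgHom y ξ‖ ≤ C * ‖vec τ y‖) : ∃ q, ξ = vec τ q := by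
  obtain ⟨q, hq⟩ := hτ.exists_eq_vec_of_right (ξ := hτ.conj ξ) C fun y ↦ by
    rw [hτ.rightMul_conj, hτ.norm_conj, ← hτ.norm_vec_star]
    exact h _
  exact ⟨star q, by rw [← hτ.conj_vec, ← hq, hτ.conj_conj]⟩

/-- The closure in `L²(Q)` of a ball of `Q` is contained in `Q`. -/
theorem exists_eq_vec_of_mem_closure (hτ : IsTypeIIOneFactor τ) {ξ : τ.GNS} (C : ℝ)
    (h : ξ ∈ closure (vec τ '' {x | ‖x‖ ≤ C})) : ∃ q, ξ = vec τ q := by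
  refine hτ.exists_eq_vec_of_right C fun y ↦ ?_
  refine closure_minimal (t := {ξ | ‖rightMul hτ.tracial y ξ‖ ≤ C * ‖vec τ y‖}) ?_
    (isClosed_le (by fun_prop) (by fun_prop)) h
  rintro _ ⟨x, hx, rfl⟩
  change ‖rightMul hτ.tracial y (vec τ x)‖ ≤ _
  rw [rightMul_vec]
  exact (hτ.norm_vec_mul_le x y).trans (mul_le_mul_of_nonneg_right hx (norm_nonneg _))

/-- On bounded subsets of `Q`, convergence in `L²(Q)` implies strong convergence to zero of the
left multiplication operators. -/
theorem tendsto_left_apply (hτ : IsTypeIIOneFactor τ) {ι : Type*} {l : Filter ι} {x : ι → Q}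
    {y : Q} (C : ℝ) (hC : ∀ i, ‖x i‖ ≤ C) (h : Tendsto (fun i ↦ vec τ (x i)) l (𝓝 (vec τ y)))
    (ξ : τ.GNS) : Tendsto (fun i ↦ τ.gnsStarAlgHom (x i) ξ) l (𝓝 (τ.gnsStarAlgHom y ξ)) := by
  have hC' : 0 ≤ |C| + ‖y‖ := by positivity
  rw [tendsto_iff_norm_sub_tendsto_zero]
  refine squeeze_zero' (.of_forall fun _ ↦ norm_nonneg _) (g := fun i ↦ ‖τ.gnsStarAlgHom (x i - y) ξ‖)
    (.of_forall fun i ↦ by simp only [map_sub]; rfl) ?_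
  rw [Metric.tendsto_nhds]
  intro ε hε
  obtain ⟨z, hz⟩ : ∃ z, ‖ξ - vec τ z‖ < ε / 2 / (|C| + ‖y‖ + 1) := by
    obtain ⟨z, hz⟩ := (dense_range_vec τ).exists_dist_lt ξ
      (show 0 < ε / 2 / (|C| + ‖y‖ + 1) by positivity)
    exact ⟨z, by rwa [← dist_eq_norm]⟩
  -- On `[z]` the convergence is controlled by the operator norm of `z` acting on the right; the
  -- uniform bound on `x i` handles the remainder `ξ - [z]`.
  have hlim : Tendsto (fun i ↦ ‖vec τ (x i) - vec τ y‖ * ‖z‖) l (𝓝 0) := by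
    simpa using (tendsto_iff_norm_sub_tendsto_zero.mp h).mul_const ‖z‖
  filter_upwards [hlim.eventually (gt_mem_nhds (half_pos hε))] with i hi
  have hxy : ‖x i - y‖ ≤ |C| + ‖y‖ :=
    (norm_sub_le _ _).trans (by linarith [hC i, le_abs_self C])
  rw [Real.dist_eq, sub_zero, abs_of_nonneg (norm_nonneg _)]
  calc ‖τ.gnsStarAlgHom (x i - y) ξ‖
      = ‖τ.gnsStarAlgHom (x i - y) (ξ - vec τ z) + vec τ ((x i - y) * z)‖ := by
        rw [← leftMul_vec, ← map_add, sub_add_cancel]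
    _ ≤ (|C| + ‖y‖) * ‖ξ - vec τ z‖ + ‖vec τ (x i) - vec τ y‖ * ‖z‖ := by
        refine (norm_add_le _ _).trans (add_le_add ?_ ?_)
        · exact (norm_left_apply_le _ _).trans (mul_le_mul_of_nonneg_right hxy (norm_nonneg _))
        · rw [← vec_sub]
          exact hτ.norm_vec_mul_le' _ _
    _ < ε / 2 + ε / 2 := by
        refine add_lt_add ?_ hi
        calc (|C| + ‖y‖) * ‖ξ - vec τ z‖ ≤ (|C| + ‖y‖ + 1) * ‖ξ - vec τ z‖ := by exact mul_le_mul_of_nonneg_right (by linarith) (norm_nonneg _)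
          _ < (|C| + ‖y‖ + 1) * (ε / 2 / (|C| + ‖y‖ + 1)) := by gcongr
          _ = ε / 2 := by field_simp
    _ = ε := add_halves ε

end IsTypeIIOneFactor

end StandardForm

/-! ### Averaging over the unitary group and intertwiners of automorphisms. -/

section Averaging

/-- Finitely supported probability weights on `α`. -/
def probWeights (α : Type*) : Set (α →₀ ℝ) := {w | (∀ a, 0 ≤ w a) ∧ (w.sum fun _ t ↦ t) = 1}

/-- The weighted average of `f` with weights `w`. -/
noncomputable def avg {α E : Type*} [AddCommGroup E] [Module ℂ E] (w : α →₀ ℝ) (f : α → E) : E :=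
  w.sum fun a t ↦ (t : ℂ) • f a

theorem convex_probWeights (α : Type*) : Convex ℝ (probWeights α) := by
  rintro w ⟨hw, hw1⟩ v ⟨hv, hv1⟩ a b ha hb hab
  refine ⟨fun x ↦ ?_, ?_⟩
  · have := mul_nonneg ha (hw x)
    have := mul_nonneg hb (hv x)
    simp only [Finsupp.add_apply, Finsupp.smul_apply, smul_eq_mul]
    positivity
  · rw [Finsupp.sum_add_index' (fun _ ↦ rfl) (fun _ _ _ ↦ rfl),
      Finsupp.sum_smul_index (fun _ ↦ rfl), Finsupp.sum_smul_index (fun _ ↦ rfl),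
      ← Finsupp.mul_sum, ← Finsupp.mul_sum, hw1, hv1, mul_one, mul_one, hab]

theorem single_mem_probWeights {α : Type*} (a : α) : Finsupp.single a 1 ∈ probWeights α := by
  classical
  refine ⟨fun x ↦ ?_, by simp⟩
  rw [Finsupp.single_apply]
  split_ifs <;> simp

theorem mapDomain_mem_probWeights {α β : Type*} (g : α → β) {w : α →₀ ℝ} (hw : w ∈ probWeights α) :
    w.mapDomain g ∈ probWeights β := by
  refine ⟨fun b ↦ ?_, ?_⟩
  · classical
    rw [Finsupp.mapDomain, Finsupp.sum_apply]
    refine Finset.sum_nonneg fun a _ ↦ ?_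
    dsimp only
    rw [Finsupp.single_apply]
    split_ifs
    exacts [hw.1 a, le_rfl]
  · rw [Finsupp.sum_mapDomain_index (fun _ ↦ rfl) (fun _ _ _ ↦ rfl), hw.2]

section

variable {α β E F : Type*} [AddCommGroup E] [Module ℂ E] [AddCommGroup F] [Module ℂ F]

theorem avg_mapDomain (g : α → β) (w : α →₀ ℝ) (f : β → E) :
    avg (w.mapDomain g) f = avg w (fun a ↦ f (g a)) :=
  Finsupp.sum_mapDomain_index (by simp) (by simp [add_smul])

theorem map_avg (T : E →ₗ[ℂ] F) (w : α →₀ ℝ) (f : α → E) :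
    T (avg w f) = avg w (fun a ↦ T (f a)) := by
  simp [avg, Finsupp.sum, map_sum]

theorem avg_const {w : α →₀ ℝ} (hw : w ∈ probWeights α) (x : E) : avg w (fun _ ↦ x) = x := by
  rw [avg, Finsupp.sum, ← Finset.sum_smul, ← Complex.ofReal_sum]
  have : ∑ i ∈ w.support, w i = 1 := hw.2
  rw [this, Complex.ofReal_one, one_smul]

theorem avg_sum {ι : Type*} (s : Finset ι) (w : α →₀ ℝ) (f : ι → α → E) :
    avg w (fun a ↦ ∑ i ∈ s, f i a) = ∑ i ∈ s, avg w (f i) := by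
  simp only [avg, Finsupp.sum, Finset.smul_sum]
  exact Finset.sum_comm

theorem star_avg [StarAddMonoid E] [StarModule ℂ E] (w : α →₀ ℝ) (f : α → E) :
    star (avg w f) = avg w (fun a ↦ star (f a)) := by
  simp [avg, Finsupp.sum, star_sum]

theorem avg_linear {w v : α →₀ ℝ} (a b : ℝ) (f : α → E) :
    avg (a • w + b • v) f = (a : ℂ) • avg w f + (b : ℂ) • avg v f := by
  rw [avg, Finsupp.sum_add_index' (by simp) (by simp [add_smul]),
    Finsupp.sum_smul_index (by simp), Finsupp.sum_smul_index (by simp)]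
  simp [avg, Finsupp.sum, Finset.smul_sum, mul_smul]

end

theorem norm_avg_le {α E : Type*} [NormedAddCommGroup E] [NormedSpace ℂ E] {w : α →₀ ℝ}
    (hw : w ∈ probWeights α) {f : α → E} {C : ℝ} (h : ∀ a, ‖f a‖ ≤ C) : ‖avg w f‖ ≤ C := by
  refine (norm_sum_le _ _).trans ?_
  calc ∑ a ∈ w.support, ‖((w a : ℝ) : ℂ) • f a‖ ≤ ∑ a ∈ w.support, w a * C := by
        refine Finset.sum_le_sum fun a _ ↦ ?_
        rw [norm_smul, Complex.norm_real, Real.norm_of_nonneg (hw.1 a)]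
        exact mul_le_mul_of_nonneg_left (h a) (hw.1 a)
    _ = C := by
        rw [← Finset.sum_mul, show ∑ i ∈ w.support, w i = 1 from hw.2, one_mul]

/-- The vector of minimal norm of a closed convex set is fixed by every norm preserving
self-map of the set. -/
theorem exists_mem_forall_fixed {E : Type*} [NormedAddCommGroup E] [InnerProductSpace ℝ E]
    [CompleteSpace E] {C : Set E} (hne : C.Nonempty) (hC : IsClosed C) (hconv : Convex ℝ C) :
    ∃ ξ ∈ C, ∀ T : E → E, (∀ ζ, ‖T ζ‖ = ‖ζ‖) → Set.MapsTo T C C → T ξ = ξ := by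
  obtain ⟨ξ, hξ, hmin⟩ := exists_norm_eq_iInf_of_complete_convex hne hC.isComplete hconv 0
  refine ⟨ξ, hξ, fun T hT hTC ↦ ?_⟩
  -- Minimality gives `⟪ξ, T ξ - ξ⟫ ≥ 0`; together with `‖T ξ‖ = ‖ξ‖` this forces `‖T ξ - ξ‖² ≤ 0`.
  have h := (norm_eq_iInf_iff_real_inner_le_zero hconv hξ).mp hmin (T ξ) (hTC hξ)
  rw [zero_sub, inner_neg_left, inner_sub_right, real_inner_self_eq_norm_sq] at h
  have h2 := norm_sub_sq_real (T ξ) ξ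
  rw [hT, real_inner_comm] at h2
  have h3 : ‖T ξ - ξ‖ ^ 2 = 0 := le_antisymm (by linarith) (sq_nonneg _)
  simpa [sub_eq_zero] using h3

/-- A linear isometry that permutes the family `F` through some `g` maps the closed convex hull of
`F` to itself, so it fixes the vector of minimal norm there. -/
theorem exists_mem_closure_avg_fixed {α E : Type*} [Nonempty α] [NormedAddCommGroup E]
    [InnerProductSpace ℂ E] [CompleteSpace E] (F : α → E) :
    ∃ ξ ∈ closure ((fun w ↦ avg w F) '' probWeights α), ∀ (T : E →ₗᵢ[ℂ] E) (g : α → α),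
      (∀ a, T (F a) = F (g a)) → T ξ = ξ := by
  let := InnerProductSpace.complexToReal (G := E)
  have hconv : Convex ℝ ((fun w ↦ avg w F) '' probWeights α) := by
    rintro _ ⟨w, hw, rfl⟩ _ ⟨v, hv, rfl⟩ a b ha hb hab
    exact ⟨_, convex_probWeights α hw hv ha hb hab, avg_linear a b F⟩
  obtain ⟨a₀⟩ := ‹Nonempty α›
  obtain ⟨ξ, hξ, h⟩ := exists_mem_forall_fixed
    (C := closure ((fun w ↦ avg w F) '' probWeights α))
    ⟨_, subset_closure ⟨_, single_mem_probWeights a₀, rfl⟩⟩ isClosed_closure hconv.closure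
  refine ⟨ξ, hξ, fun T g hTg ↦ h T T.norm_map (Set.MapsTo.closure ?_ T.continuous)⟩
  rintro _ ⟨w, hw, rfl⟩
  refine ⟨_, mapDomain_mem_probWeights g hw, ?_⟩
  simp only [avg_mapDomain, ← hTg]
  exact (map_avg T.toLinearMap w F).symm

variable {Q : Type*} [CStarAlgebra Q] [PartialOrder Q] [StarOrderedRing Q] {τ : Q →ₚ[ℂ] ℂ}

theorem vec_avg {α : Type*} (w : α →₀ ℝ) (f : α → Q) :
    vec τ (avg w f) = avg w (fun a ↦ vec τ (f a)) :=
  map_avg (vecₗ τ) w f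

theorem avg_mul {Q α : Type*} [CStarAlgebra Q] (w : α →₀ ℝ) (f : α → Q) (x : Q) :
    avg w (fun a ↦ f a * x) = avg w f * x :=
  (map_avg (LinearMap.mulRight ℂ x) w f).symm

theorem mul_avg {Q α : Type*} [CStarAlgebra Q] (w : α →₀ ℝ) (f : α → Q) (x : Q) :
    avg w (fun a ↦ x * f a) = x * avg w f :=
  (map_avg (LinearMap.mulLeft ℂ x) w f).symm

theorem star_coe_unitary_mul_self_map (θ : Q ≃⋆ₐ[ℂ] Q) (u : unitary Q) :
    star (θ u) * θ u = 1 := by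
  rw [← map_star, ← map_mul, Unitary.coe_star_mul_self, map_one]

theorem coe_unitary_mul_star_self_map (θ : Q ≃⋆ₐ[ℂ] Q) (u : unitary Q) :
    θ u * star (θ u) = 1 := by
  rw [← map_star, ← map_mul, (Unitary.mem_iff.mp u.2).2, map_one]

theorem map_unitary_mem (θ : Q ≃⋆ₐ[ℂ] Q) (u : unitary Q) : θ u ∈ unitary Q :=
  ⟨star_coe_unitary_mul_self_map θ u, coe_unitary_mul_star_self_map θ u⟩

namespace IsTypeIIOneFactor

theorem norm_vec_mul_unitary (hτ : IsTypeIIOneFactor τ) (u : unitary Q) (x : Q) :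
    ‖vec τ (x * (u : Q))‖ = ‖vec τ x‖ := by
  rw [← hτ.norm_vec_star, star_mul, ← hτ.norm_vec_star x]
  exact hτ.norm_vec_unitary_mul (star u) _

theorem norm_unitary_le (hτ : IsTypeIIOneFactor τ) {u : Q} (hu : u ∈ unitary Q) : ‖u‖ ≤ 1 :=
  haveI := hτ.nontrivial
  (CStarRing.norm_of_mem_unitary hu).le

theorem norm_conj_le (hτ : IsTypeIIOneFactor τ) (θ σ : Q ≃⋆ₐ[ℂ] Q) (x : Q) (u : unitary Q) :
    ‖θ u * x * star (σ u)‖ ≤ ‖x‖ := by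
  calc ‖θ u * x * star (σ u)‖ ≤ ‖θ u‖ * ‖x‖ * ‖star (σ u)‖ :=
        (norm_mul_le _ _).trans (mul_le_mul_of_nonneg_right (norm_mul_le _ _) (norm_nonneg _))
    _ ≤ 1 * ‖x‖ * 1 := by
        rw [norm_star]
        gcongr
        · exact hτ.norm_unitary_le (map_unitary_mem θ u)
        · exact hτ.norm_unitary_le (map_unitary_mem σ u)
    _ = ‖x‖ := by ring

theorem norm_left_right_unitary (hτ : IsTypeIIOneFactor τ) {u v : Q} (hu : u ∈ unitary Q)
    (hv : v ∈ unitary Q) (ξ : τ.GNS) :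
    ‖τ.gnsStarAlgHom u (rightMul hτ.tracial v ξ)‖ = ‖ξ‖ := by
  refine induction_vec ξ (by apply isClosed_eq <;> fun_prop) fun x ↦ ?_
  rw [rightMul_vec, leftMul_vec, hτ.norm_vec_unitary_mul ⟨u, hu⟩, hτ.norm_vec_mul_unitary ⟨v, hv⟩]

/-- Averaging over the unitary group: the averages of `θᵢ(u) xᵢ σᵢ(u)*` converge in `L²(Q)`,
simultaneously in `i`, to elements of `Q` that intertwine `θᵢ` and `σᵢ`. -/
theorem exists_average (hτ : IsTypeIIOneFactor τ) {ι : Type*} [Finite ι]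
    (θ σ : ι → Q ≃⋆ₐ[ℂ] Q) (x : ι → Q) :
    ∃ q : ι → Q, (∀ i y, θ i y * q i = q i * σ i y) ∧
      ∃ w : ℕ → (unitary Q →₀ ℝ), (∀ n, w n ∈ probWeights (unitary Q)) ∧
        ∀ i, Tendsto (fun n ↦ vec τ (avg (w n) fun u ↦ θ i u * x i * star (σ i u))) atTop
          (𝓝 (vec τ (q i))) := by
  have := Fintype.ofFinite ι
  -- Working in the Hilbert sum over `ι` makes one sequence of weights serve all indices at once.
  let F : unitary Q → PiLp 2 (fun _ : ι ↦ τ.GNS) := fun u ↦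
    WithLp.toLp 2 fun i ↦ vec τ (θ i u * x i * star (σ i u))
  obtain ⟨ξ, hξ, hfix⟩ := exists_mem_closure_avg_fixed F
  obtain ⟨s, hs, hlim⟩ := mem_closure_iff_seq_limit.mp hξ
  choose w hw hws using hs
  have hF (w : unitary Q →₀ ℝ) (i : ι) :
      avg w F i = vec τ (avg w fun u ↦ θ i u * x i * star (σ i u)) := by
    rw [vec_avg]
    exact map_avg (PiLp.proj 2 (𝕜 := ℂ) (fun _ : ι ↦ τ.GNS) i).toLinearMap w F
  have hlim' (i : ι) : Tendsto (fun n ↦ vec τ (avg (w n) fun u ↦ θ i u * x i * star (σ i u))) atTop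
      (𝓝 (ξ i)) := by
    refine (((PiLp.proj 2 (𝕜 := ℂ) (fun _ : ι ↦ τ.GNS) i).continuous.tendsto ξ).comp hlim).congr
      fun n ↦ ?_
    rw [← hF, Function.comp_apply, ← hws]
    rfl
  -- All averages stay in the ball of radius `‖x i‖` of `Q`, so the limit vector comes from `Q`.
  have hbd (i : ι) : ∃ q, ξ i = vec τ q :=
    hτ.exists_eq_vec_of_mem_closure ‖x i‖ <| mem_closure_of_tendsto (hlim' i) <| .of_forall
      fun n ↦ ⟨_, norm_avg_le (hw n) fun u ↦ hτ.norm_conj_le (θ i) (σ i) (x i) u, rfl⟩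
  choose q hq using hbd
  refine ⟨q, fun i ↦ ?_, w, hw, fun i ↦ hq i ▸ hlim' i⟩
  have key (v : unitary Q) : θ i v * q i = q i * σ i v := by
    -- This isometry sends `F u` to `F (v * u)`, so it fixes `ξ`; that is the intertwining relation
    -- at `v`. Unitaries span `Q`, which gives it everywhere.
    let T : PiLp 2 (fun _ : ι ↦ τ.GNS) →ₗᵢ[ℂ] PiLp 2 (fun _ : ι ↦ τ.GNS) :=
      { toFun := fun ζ ↦ WithLp.toLp 2 fun i ↦
          τ.gnsStarAlgHom (θ i v) (rightMul hτ.tracial (star (σ i v)) (ζ i))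
        map_add' := fun ζ η ↦ by ext i; simp only [PiLp.add_apply, map_add]
        map_smul' := fun c ζ ↦ by
          ext i; simp only [PiLp.smul_apply, map_smul, RingHom.id_apply]
        norm_map' := fun ζ ↦ by
          change ‖WithLp.toLp 2 fun i ↦
            τ.gnsStarAlgHom (θ i v) (rightMul hτ.tracial (star (σ i v)) (ζ i))‖ = _
          rw [PiLp.norm_eq_of_L2, PiLp.norm_eq_of_L2]
          congr 1
          refine Finset.sum_congr rfl fun i _ ↦ ?_
          rw [← hτ.norm_left_right_unitary (map_unitary_mem (θ i) v)
            (Unitary.star_mem (map_unitary_mem (σ i) v)) (ζ i)] }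
    have hT := hfix T (fun u ↦ v * u) fun u ↦ by
      ext i
      change τ.gnsStarAlgHom (θ i v) (rightMul hτ.tracial (star (σ i v))
        (vec τ (θ i u * x i * star (σ i u)))) = vec τ (θ i ↑(v * u) * x i * star (σ i ↑(v * u)))
      rw [rightMul_vec, leftMul_vec]
      simp only [Submonoid.coe_mul, map_mul, star_mul, mul_assoc]
    have hTi : τ.gnsStarAlgHom (θ i v) (rightMul hτ.tracial (star (σ i v)) (ξ i)) = ξ i :=
      congrArg (fun ζ : PiLp 2 (fun _ : ι ↦ τ.GNS) ↦ ζ i) hT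
    rw [hq, rightMul_vec, leftMul_vec] at hTi
    calc θ i v * q i = θ i v * (q i * star (σ i v)) * σ i v := by
          rw [mul_assoc, mul_assoc, star_coe_unitary_mul_self_map, mul_one]
      _ = q i * σ i v := by rw [hτ.vec_injective hTi]
  intro y
  have hy : y ∈ Submodule.span ℂ (unitary Q : Set Q) := by
    rw [CStarAlgebra.span_unitary]; trivial
  induction hy using Submodule.span_induction with
  | mem y hy => exact key ⟨y, hy⟩
  | zero => simp
  | add y z _ _ hy hz => rw [map_add, map_add, add_mul, mul_add, hy, hz]
  | smul c y _ hy => rw [map_smul, map_smul, smul_mul_assoc, mul_smul_comm, hy]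

/-- An element of `Q` commuting with all of `Q` is a scalar, determined by the trace. -/
theorem eq_trace_smul_one (hτ : IsTypeIIOneFactor τ) {z : Q} (h : ∀ x, z * x = x * z) :
    z = τ z • (1 : Q) := by
  obtain ⟨c, rfl⟩ := hτ.factor z h
  rw [Algebra.algebraMap_eq_smul_one, map_smul, hτ.map_one, smul_eq_mul, mul_one]

/-- A nonzero intertwiner between two automorphisms is a scalar multiple of a unitary, so that the
automorphisms agree up to an inner automorphism. -/
theorem mk_eq_mk_of_intertwiner (hτ : IsTypeIIOneFactor τ) {θ σ : Q ≃⋆ₐ[ℂ] Q} {q : Q} (hq : q ≠ 0)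
    (h : ∀ y, θ y * q = q * σ y) : (QuotientGroup.mk θ : Out Q) = QuotientGroup.mk σ := by
  have hs (y : Q) : star q * θ y = σ y * star q := by
    have := congrArg star (h (star y))
    rwa [star_mul, star_mul, map_star, map_star, star_star, star_star] at this
  -- `q* q` commutes with the range of `σ` and `q q*` with the range of `θ`, so both are scalars,
  -- equal by traciality; rescaling `q` by `1 / ‖[q]‖` gives a unitary.
  have h1 : star q * q = τ (star q * q) • (1 : Q) := hτ.eq_trace_smul_one fun x ↦ by
    obtain ⟨y, rfl⟩ := EquivLike.surjective σ x
    rw [mul_assoc, ← h, ← mul_assoc, hs, mul_assoc]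
  have h2 : q * star q = τ (q * star q) • (1 : Q) := hτ.eq_trace_smul_one fun x ↦ by
    obtain ⟨y, rfl⟩ := EquivLike.surjective θ x
    rw [mul_assoc, hs, ← mul_assoc, ← h, mul_assoc]
  rw [hτ.tracial, ← norm_vec_sq] at h2
  rw [← norm_vec_sq] at h1
  set r := ‖vec τ q‖ with hr
  have hr0 : r ≠ 0 := fun h0 ↦ hq (hτ.vec_injective (by
    rw [vec_zero]; exact norm_eq_zero.mp h0))
  have hr0' : (r : ℂ) ≠ 0 := by exact_mod_cast hr0
  have hs' : star (r : ℂ)⁻¹ = (r : ℂ)⁻¹ := by simp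
  have hc : (r : ℂ)⁻¹ * (r : ℂ)⁻¹ * ((r ^ 2 : ℝ) : ℂ) = 1 := by
    push_cast
    field_simp
  have hw : ((r : ℂ)⁻¹ • q) ∈ unitary Q := by
    constructor
    · rw [star_smul, hs', smul_mul_smul_comm, h1, smul_smul, hc, one_smul]
    · rw [star_smul, hs', smul_mul_smul_comm, h2, smul_smul, hc, one_smul]
  rw [QuotientGroup.eq_iff_div_mem]
  refine ⟨⟨_, hw⟩, ?_⟩
  rw [eq_div_iff_mul_eq']
  ext y
  change ((r : ℂ)⁻¹ • q) * σ y * star ((r : ℂ)⁻¹ • q) = θ y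
  rw [smul_mul_assoc, ← h, ← mul_smul_comm, mul_assoc, hw.2, mul_one]

end IsTypeIIOneFactor

end Averaging

/-! ### Automorphisms of a II₁ factor preserve the trace. -/

section TraceUnique

variable {Q : Type*} [CStarAlgebra Q] [PartialOrder Q] [StarOrderedRing Q] {τ : Q →ₚ[ℂ] ℂ}

/-- The difference of the two sides is `s (1 + s)⁻¹ s`. The function `s ↦ 1 - (1 + s)⁻¹` is operator
monotone with values in `[0, 1]`; it serves to replace unbounded partial sums by bounded elements.
-/
theorem one_sub_inverse_one_add_le {s : Q} (hs : 0 ≤ s) : 1 - Ring.inverse (1 + s) ≤ s := by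
  have hu : IsUnit (1 + s) := CStarAlgebra.isUnit_of_le 1 (by simpa using hs)
  obtain ⟨v, hv⟩ := hu
  have hv0 : (0 : Q) ≤ v := hv ▸ add_nonneg zero_le_one hs
  rw [← hv, Ring.inverse_unit, ← sub_nonneg]
  have e : s - (1 - ↑v⁻¹) = star s * ↑v⁻¹ * s := by
    have h1 : s = v - 1 := by rw [hv]; abel
    rw [hs.isSelfAdjoint.star_eq, h1, sub_mul, sub_mul, mul_sub, mul_sub]
    simp
  rw [e]
  exact star_left_conjugate_nonneg (CFC.inv_nonneg_of_nonneg v hv0) s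

/-- The difference is `(1 / 2) (1 + y)⁻¹ (y - y²)`, a product of commuting positive elements. -/
theorem half_smul_le_one_sub_inverse_one_add {y : Q} (hy : 0 ≤ y) (hy1 : y ≤ 1) :
    (1 / 2 : ℝ) • y ≤ 1 - Ring.inverse (1 + y) := by
  have hu : IsUnit (1 + y) := CStarAlgebra.isUnit_of_le 1 (by simpa using hy)
  obtain ⟨v, hv⟩ := hu
  have hv0 : (0 : Q) ≤ v := hv ▸ add_nonneg zero_le_one hy
  rw [← hv, Ring.inverse_unit, ← sub_nonneg]
  have hyy : 0 ≤ y - y ^ 2 := by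
    simpa using CStarAlgebra.pow_antitone hy hy1 one_le_two
  have h1 : y = v - 1 := by rw [hv]; abel
  have hc : Commute (↑v⁻¹ : Q) (y - y ^ 2) := by
    have : Commute (↑v⁻¹ : Q) y := by
      rw [h1]
      exact (Commute.sub_right (by simp [commute_iff_eq]) (Commute.one_right _))
    exact this.sub_right (this.pow_right 2)
  have e : 1 - ↑v⁻¹ - (1 / 2 : ℝ) • y = (1 / 2 : ℝ) • (↑v⁻¹ * (y - y ^ 2)) := by
    rw [show (1 : Q) - ↑v⁻¹ = (1 / 2 : ℝ) • ((2 : ℝ) • (1 - ↑v⁻¹)) by simp [smul_smul], ← smul_sub]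
    congr 1
    have h2 : (↑v⁻¹ : Q) * y = 1 - ↑v⁻¹ := by rw [h1, mul_sub, Units.inv_mul, mul_one]
    rw [sq, mul_sub, ← mul_assoc, h2, sub_mul, one_mul, h2, two_smul]
    abel
  rw [e]
  exact smul_nonneg (by norm_num)
    (hc.mul_nonneg (CFC.inv_nonneg_of_nonneg v hv0) hyy)

namespace IsTypeIIOneFactor

theorem inner_vec_one_left (x : Q) : ⟪vec τ 1, vec τ x⟫_ℂ = τ x := by
  rw [inner_vec, star_one, one_mul]

theorem tendsto_trace {ι : Type*} {l : Filter ι} {x : ι → Q} {y : Q}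
    (h : Tendsto (fun i ↦ vec τ (x i)) l (𝓝 (vec τ y))) :
    Tendsto (fun i ↦ τ (x i)) l (𝓝 (τ y)) := by
  have := (tendsto_const_nhds (x := vec τ 1)).inner (𝕜 := ℂ) h
  simpa only [inner_vec_one_left] using this

/-- The positive cone of `Q` is closed in `Q` for the `L²`-topology. -/
theorem nonneg_of_tendsto (hτ : IsTypeIIOneFactor τ) {ι : Type*} {l : Filter ι} [l.NeBot]
    {x : ι → Q} {y : Q} (h : Tendsto (fun i ↦ vec τ (x i)) l (𝓝 (vec τ y)))
    (hx : ∀ i, 0 ≤ x i) : 0 ≤ y := by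
  have hy : IsSelfAdjoint y := by
    refine hτ.vec_injective ?_
    rw [← hτ.conj_vec]
    refine tendsto_nhds_unique ((hτ.continuous_conj.tendsto _).comp h) (h.congr fun i ↦ ?_)
    rw [Function.comp_apply, hτ.conj_vec, (hx i).isSelfAdjoint.star_eq]
  have hm0 : 0 ≤ y⁻ := CFC.negPart_nonneg y
  have hms : star y⁻ = y⁻ := hm0.isSelfAdjoint.star_eq
  have hyd : y⁺ - y⁻ = y := CFC.posPart_sub_negPart y
  have hpm : y⁺ * y⁻ = 0 := CFC.posPart_mul_negPart y
  -- Compressing by the negative part turns `y` into `-(y⁻)³`, whose trace is then both `≤ 0` and a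
  -- limit of nonnegative numbers; faithfulness gives `y⁻ = 0`.
  have hlim : Tendsto (fun i ↦ τ (y⁻ * x i * y⁻)) l (𝓝 (τ (y⁻ * y * y⁻))) := by
    have := ((rightMul hτ.tracial y⁻).continuous.tendsto _).comp
      (((τ.gnsStarAlgHom y⁻).continuous.tendsto _).comp h)
    refine tendsto_trace ?_
    simpa only [Function.comp_def, leftMul_vec, rightMul_vec] using this
  have hge : 0 ≤ τ (y⁻ * y * y⁻) := ge_of_tendsto hlim <| .of_forall fun i ↦
    τ.map_nonneg (by simpa [hms] using star_left_conjugate_nonneg (hx i) y⁻)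
  obtain ⟨b, hb⟩ := CStarAlgebra.nonneg_iff_eq_star_mul_self.mp hm0
  have e : y⁻ * y * y⁻ = -(star (b * y⁻) * (b * y⁻)) := by
    have h1 : y * y⁻ = -(y⁻ * y⁻) := by
      nth_rewrite 1 [← hyd]
      rw [sub_mul, hpm, zero_sub]
    rw [mul_assoc, h1, mul_neg, star_mul, hms, mul_assoc, ← mul_assoc (star b), ← hb]
  rw [e, map_neg, neg_nonneg] at hge
  have hbm := hτ.faithful _ (le_antisymm hge (τ.map_nonneg (star_mul_self_nonneg _)))
  have hmm : star y⁻ * y⁻ = 0 := by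
    rw [hms]
    nth_rewrite 1 [hb]
    rw [mul_assoc, hbm, mul_zero]
  have hm : y⁻ = 0 := (CStarRing.star_mul_self_eq_zero_iff _).mp hmm
  rw [← hyd, hm, sub_zero]
  exact CFC.posPart_nonneg y

/-- Bounded increasing sequences in `Q` converge in `L²(Q)` to an element of `Q`. -/
theorem exists_tendsto_of_monotone (hτ : IsTypeIIOneFactor τ) {r : ℕ → Q} (hr : Monotone r)
    (h0 : ∀ n, 0 ≤ r n) (h1 : ∀ n, r n ≤ 1) :
    ∃ s, Tendsto (fun n ↦ vec τ (r n)) atTop (𝓝 (vec τ s)) := by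
  have hmono {a b : Q} (hab : a ≤ b) : (τ a).re ≤ (τ b).re :=
    (Complex.le_def.mp (OrderHomClass.mono τ hab)).1
  -- The increment `d = r n - r m` satisfies `0 ≤ d ≤ 1`, so `d² ≤ d`: its `L²`-norm squared is at
  -- most the increment of the traces, which converge.
  have hdist {m n : ℕ} (hmn : m ≤ n) :
      ‖vec τ (r n) - vec τ (r m)‖ ^ 2 ≤ (τ (r n)).re - (τ (r m)).re := by
    have hd0 : 0 ≤ r n - r m := sub_nonneg.mpr (hr hmn)
    have hd1 : r n - r m ≤ 1 := (sub_le_self _ (h0 m)).trans (h1 n)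
    rw [← vec_sub, norm_vec_sq', hd0.isSelfAdjoint.star_eq, ← Complex.sub_re, ← map_sub]
    refine hmono ?_
    simpa [sq] using CStarAlgebra.pow_antitone hd0 hd1 one_le_two
  have ht : CauchySeq fun n ↦ (τ (r n)).re := by
    refine (tendsto_atTop_ciSup (fun m n hmn ↦ hmono (hr hmn)) ⟨1, ?_⟩).cauchySeq
    rintro _ ⟨n, rfl⟩
    simpa [hτ.map_one] using hmono (h1 n)
  have hc : CauchySeq fun n ↦ vec τ (r n) := by
    rw [Metric.cauchySeq_iff'] at ht ⊢
    intro ε hε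
    obtain ⟨N, hN⟩ := ht (ε ^ 2) (by positivity)
    refine ⟨N, fun n hn ↦ ?_⟩
    rw [dist_eq_norm, ← sq_lt_sq₀ (norm_nonneg _) hε.le]
    exact (hdist hn).trans_lt ((le_abs_self _).trans_lt (hN n hn))
  obtain ⟨ξ, hξ⟩ := cauchySeq_tendsto_of_complete hc
  obtain ⟨s, rfl⟩ := hτ.exists_eq_vec_of_mem_closure 1 <| mem_closure_of_tendsto hξ <| .of_forall
    fun n ↦ ⟨r n, (CStarAlgebra.norm_le_one_iff_of_nonneg _ (h0 n)).mpr (h1 n), rfl⟩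
  exact ⟨s, hξ⟩

/-- A sequence of positive contractions whose traces have a small sum is dominated by an element
of small trace. -/
theorem exists_dominating (hτ : IsTypeIIOneFactor τ) {y : ℕ → Q} (h0 : ∀ n, 0 ≤ y n)
    (h1 : ∀ n, y n ≤ 1) {ε : ℝ} (hε : ∀ k, ∑ n ∈ Finset.range k, (τ (y n)).re ≤ ε) :
    ∃ r : Q, (∀ n, (1 / 2 : ℝ) • y n ≤ r) ∧ (τ r).re ≤ ε := by
  let s : ℕ → Q := fun k ↦ ∑ n ∈ Finset.range k, y n
  have hs0 (k) : 0 ≤ s k := Finset.sum_nonneg fun n _ ↦ h0 n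
  have hsm : Monotone s := monotone_nat_of_le_succ fun k ↦ by
    simp only [s, Finset.sum_range_succ]
    exact le_add_of_nonneg_right (h0 k)
  have hpos {a : Q} (ha : 0 ≤ a) : IsStrictlyPositive (1 + a) :=
    IsStrictlyPositive.of_le (a := 1) (by exact isStrictlyPositive_one) (by simpa using ha)
  -- The sums `s k` need not be bounded in norm, but `r k = s k (1 + s k)⁻¹` increases, stays below
  -- `1` and has trace at most that of `s k`. Its limit is the dominating element.
  let r : ℕ → Q := fun k ↦ 1 - Ring.inverse (1 + s k)
  have hinv {a b : Q} (ha : 0 ≤ a) (hab : a ≤ b) :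
      1 - Ring.inverse (1 + a) ≤ 1 - Ring.inverse (1 + b) :=
    sub_le_sub_left (CStarAlgebra.ringInverse_le_ringInverse (add_le_add_right hab 1) (hpos ha)) 1
  have hrm : Monotone r := fun m n hmn ↦ hinv (hs0 m) (hsm hmn)
  have hr0 (k) : 0 ≤ r k := by
    have := hinv le_rfl (hs0 k)
    rwa [add_zero, Ring.inverse_one, sub_self] at this
  have hr1 (k) : r k ≤ 1 := by
    obtain ⟨v, hv⟩ := (hpos (hs0 k)).isUnit
    refine sub_le_self _ ?_
    rw [← hv, Ring.inverse_unit]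
    exact CFC.inv_nonneg_of_nonneg v (hv ▸ (hpos (hs0 k)).nonneg)
  obtain ⟨a, ha⟩ := hτ.exists_tendsto_of_monotone hrm hr0 hr1
  refine ⟨a, fun n ↦ ?_, ?_⟩
  · have hle (k) : (1 / 2 : ℝ) • y n ≤ r (k + (n + 1)) := by
      refine (half_smul_le_one_sub_inverse_one_add (h0 n) (h1 n)).trans (hinv (h0 n) ?_)
      exact Finset.single_le_sum (f := y) (fun i _ ↦ h0 i) (Finset.mem_range.mpr (by omega))
    rw [← sub_nonneg]
    refine hτ.nonneg_of_tendsto (l := atTop) (x := fun k ↦ r (k + (n + 1)) - (1 / 2 : ℝ) • y n) ?_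
      fun k ↦ sub_nonneg.mpr (hle k)
    simp only [vec_sub]
    exact ((tendsto_add_atTop_iff_nat (n + 1)).mpr ha).sub_const _
  · have := (Complex.continuous_re.tendsto _).comp (tendsto_trace ha)
    refine le_of_tendsto this (.of_forall fun k ↦ ?_)
    have hle := (Complex.le_def.mp (OrderHomClass.mono τ (one_sub_inverse_one_add_le (hs0 k)))).1
    refine hle.trans ?_
    simpa [s] using hε k

/-- Automorphisms of `Q` cannot map a bounded positive sequence tending to zero in `L²(Q)` to a
sequence tending to a nonzero scalar. -/
theorem eq_zero_of_tendsto_map (hτ : IsTypeIIOneFactor τ) (θ : Q ≃⋆ₐ[ℂ] Q) {y : ℕ → Q}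
    (h0 : ∀ n, 0 ≤ y n) (h1 : ∀ n, y n ≤ 1) (hy : Tendsto (fun n ↦ τ (y n)) atTop (𝓝 0))
    {c : ℝ} (hc : Tendsto (fun n ↦ vec τ (θ (y n))) atTop (𝓝 (vec τ (c • 1)))) : c ≤ 0 := by
  refine le_of_forall_pos_le_add fun ε hε ↦ ?_
  have hre : Tendsto (fun n ↦ (τ (y n)).re) atTop (𝓝 0) :=
    (Complex.continuous_re.tendsto _).comp hy
  -- Along this subsequence the traces have sum at most `ε / 2`. The dominating `r` then satisfies
  -- `θ r ≥ (1 / 2) θ (y (φ n))`, and in the limit `θ r ≥ c / 2`. Hence `r ≥ c / 2`, and taking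
  -- traces gives `c ≤ ε`.
  obtain ⟨φ, hφ, hle⟩ := extraction_forall_of_eventually
    (P := fun n k ↦ (τ (y k)).re ≤ ε / 2 / 2 / 2 ^ n)
    fun n ↦ hre.eventually (ge_mem_nhds (by positivity))
  obtain ⟨r, hr, hrε⟩ := hτ.exists_dominating (y := y ∘ φ) (ε := ε / 2) (fun n ↦ h0 _)
    (fun n ↦ h1 _) fun k ↦ by
      refine (Finset.sum_le_sum fun n _ ↦ hle n).trans ?_
      refine (Summable.sum_le_tsum _ (fun n _ ↦ by positivity)
        (summable_geometric_two' (ε / 2))).trans (tsum_geometric_two' _).le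
  have hpos : 0 ≤ θ r - (1 / 2 : ℝ) • (c • (1 : Q)) := by
    refine hτ.nonneg_of_tendsto (l := atTop) (x := fun n ↦ θ (r - (1 / 2 : ℝ) • y (φ n))) ?_
      fun n ↦ map_nonneg θ (sub_nonneg.mpr (hr n))
    have hmap (x : Q) : θ (r - (1 / 2 : ℝ) • x) = θ r - (1 / 2 : ℝ) • θ x := by
      rw [map_sub, ← Complex.coe_smul, map_smul, Complex.coe_smul]
    have hvs (x : Q) : vec τ ((1 / 2 : ℝ) • x) = ((1 / 2 : ℝ) : ℂ) • vec τ x := by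
      rw [← Complex.coe_smul, vec_smul]
    simp only [hmap, vec_sub, hvs]
    exact ((hc.comp hφ.tendsto_atTop).const_smul _).const_sub _
  have hpos' : 0 ≤ r - (c / 2 : ℝ) • (1 : Q) := by
    have := map_nonneg θ.symm hpos
    rw [map_sub, smul_smul, ← Complex.coe_smul, map_smul, StarAlgEquiv.symm_apply_apply,
      show θ.symm 1 = 1 from _root_.map_one (θ.symm : Q →⋆ₐ[ℂ] Q), Complex.coe_smul] at this
    convert this using 3
    ring
  have := (Complex.le_def.mp (τ.map_nonneg hpos')).1
  rw [map_sub, ← Complex.coe_smul, map_smul, hτ.map_one] at this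
  simp at this
  linarith

/-- Automorphisms of a II₁ factor preserve the trace. -/
theorem trace_map (hτ : IsTypeIIOneFactor τ) (θ : Q ≃⋆ₐ[ℂ] Q) (x : Q) : τ (θ x) = τ x := by
  -- The same weights average `x` under conjugation by `u` and `θ x` under conjugation by `θ u`.
  -- Thus averages `z n` tend to `τ x` while their images `θ (z n)` tend to `τ (θ x)`.
  obtain ⟨q, hq, w, hw, hlim⟩ := hτ.exists_average (fun b : Bool ↦ cond b θ 1)
    (fun b ↦ cond b θ 1) (fun b ↦ cond b (θ x) x)
  let z : ℕ → Q := fun n ↦ avg (w n) fun u ↦ (u : Q) * x * star (u : Q)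
  have hθz (n) : θ (z n) = avg (w n) fun u ↦ θ u * θ x * star (θ u) := by
    refine (map_avg (θ : Q →ₗ[ℂ] Q) (w n) _).trans ?_
    congr 1
    ext u
    simp [map_star]
  have hz : Tendsto (fun n ↦ vec τ (z n)) atTop (𝓝 (vec τ (q false))) := hlim false
  have hz' : Tendsto (fun n ↦ vec τ (θ (z n))) atTop (𝓝 (vec τ (q true))) := by
    simpa only [hθz, cond_true] using hlim true
  have hτavg (n) (σ : Q ≃⋆ₐ[ℂ] Q) (a : Q) : τ (avg (w n) fun u ↦ σ u * a * star (σ u)) = τ a := by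
    refine (map_avg τ.toLinearMap (w n) _).trans ?_
    refine Eq.trans ?_ (avg_const (hw n) (τ a))
    congr 1
    ext u
    change τ (σ u * a * star (σ u)) = τ a
    rw [hτ.tracial, ← mul_assoc, star_coe_unitary_mul_self_map, one_mul]
  have hq0 : q false = τ x • (1 : Q) := by
    rw [hτ.eq_trace_smul_one (z := q false) fun y ↦ (hq false y).symm]
    congr 1
    exact tendsto_nhds_unique (tendsto_trace hz)
      (tendsto_const_nhds.congr fun n ↦ (hτavg n 1 x).symm)
  have hq1 : q true = τ (θ x) • (1 : Q) := by
    rw [hτ.eq_trace_smul_one (z := q true) fun y ↦ by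
      obtain ⟨y, rfl⟩ := EquivLike.surjective θ y
      exact (hq true y).symm]
    congr 1
    exact tendsto_nhds_unique (tendsto_trace hz')
      (tendsto_const_nhds.congr fun n ↦ by rw [hθz, hτavg])
  set a := τ x
  set b := τ (θ x)
  rw [hq0] at hz
  rw [hq1] at hz'
  let d : ℕ → Q := fun n ↦ z n - a • 1
  let M : ℝ := ‖x‖ + ‖a • (1 : Q)‖ + 1
  have hM : 0 < M := by positivity
  have hd (n) : ‖d n‖ ≤ M := by
    refine (norm_sub_le _ _).trans ?_
    have : ‖z n‖ ≤ ‖x‖ := norm_avg_le (hw n) fun u ↦ hτ.norm_conj_le 1 1 x u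
    linarith
  have hθd (n) : ‖θ (d n)‖ ≤ M := (NonUnitalStarAlgHom.norm_apply_le θ _).trans (hd n)
  have hdlim : Tendsto (fun n ↦ ‖vec τ (d n)‖) atTop (𝓝 0) := by
    simp only [d, vec_sub]
    exact tendsto_iff_norm_sub_tendsto_zero.mp hz
  have hθdlim : Tendsto (fun n ↦ vec τ (θ (d n))) atTop (𝓝 (vec τ ((b - a) • (1 : Q)))) := by
    simp only [d, map_sub, map_smul, _root_.map_one, vec_sub, sub_smul]
    exact hz'.sub_const _
  -- The elements `d n* d n / M²` are positive contractions with trace tending to zero, whereas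
  -- their images under `θ` tend to the scalar `‖b - a‖² / M²`.
  have hle : ‖b - a‖ ^ 2 / M ^ 2 ≤ 0 := by
    refine hτ.eq_zero_of_tendsto_map θ (y := fun n ↦ (((M ^ 2)⁻¹ : ℝ) : ℂ) • (star (d n) * d n))
      (fun n ↦ ?_) (fun n ↦ ?_) ?_ ?_
    · rw [Complex.coe_smul]
      exact smul_nonneg (by positivity) (star_mul_self_nonneg _)
    · rw [Complex.coe_smul, ← CStarAlgebra.norm_le_one_iff_of_nonneg _
        (smul_nonneg (by positivity) (star_mul_self_nonneg _)), norm_smul,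
        CStarRing.norm_star_mul_self, Real.norm_of_nonneg (by positivity), inv_mul_le_one₀
        (by positivity), sq]
      exact mul_le_mul (hd n) (hd n) (norm_nonneg _) hM.le
    · simp only [map_smul, ← norm_vec_sq, smul_eq_mul, ← Complex.ofReal_mul]
      have := ((hdlim.pow 2).const_mul (M ^ 2)⁻¹)
      simp only [ne_eq, OfNat.ofNat_ne_zero, not_false_eq_true, zero_pow, mul_zero] at this
      exact_mod_cast (Complex.continuous_ofReal.tendsto _).comp this
    -- Split `θ(d n)* [θ(d n)]` as `θ(d n)*` applied to the limit vector plus `θ(d n)*` applied to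
    -- an error tending to zero.
    · have h1 : Tendsto (fun n ↦ τ.gnsStarAlgHom (star (θ (d n))) (vec τ ((b - a) • (1 : Q)))) atTop
          (𝓝 (τ.gnsStarAlgHom (star ((b - a) • (1 : Q))) (vec τ ((b - a) • (1 : Q))))) := by
        refine hτ.tendsto_left_apply M (fun n ↦ by rw [norm_star]; exact hθd n) ?_ _
        simp only [← hτ.conj_vec]
        exact (hτ.continuous_conj.tendsto _).comp hθdlim
      have h2 : Tendsto (fun n ↦ τ.gnsStarAlgHom (star (θ (d n)))
          (vec τ (θ (d n)) - vec τ ((b - a) • (1 : Q)))) atTop (𝓝 0) := by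
        refine squeeze_zero_norm (fun n ↦ ?_) (a := fun n ↦
          M * ‖vec τ (θ (d n)) - vec τ ((b - a) • (1 : Q))‖) ?_
        · refine (norm_left_apply_le _ _).trans ?_
          rw [norm_star]
          exact mul_le_mul_of_nonneg_right (hθd n) (norm_nonneg _)
        · simpa using (tendsto_iff_norm_sub_tendsto_zero.mp hθdlim).const_mul M
      have h3 := (h2.add h1).const_smul (((M ^ 2)⁻¹ : ℝ) : ℂ)
      simp only [map_sub, sub_add_cancel, zero_add, leftMul_vec, ← vec_smul] at h3
      simp only [map_smul, map_mul, map_star]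
      convert h3 using 3
      rw [star_smul, star_one, smul_mul_smul_comm, mul_one, smul_smul, ← Complex.coe_smul]
      congr 1
      rw [show star (b - a) * (b - a) = (‖b - a‖ : ℂ) ^ 2 from Complex.conj_mul' _]
      push_cast
      ring
  have h0 : ‖b - a‖ ^ 2 ≤ 0 := by
    rw [div_le_iff₀ (by positivity)] at hle
    linarith
  have : ‖b - a‖ = 0 := by
    have := sq_nonneg ‖b - a‖
    exact pow_eq_zero_iff two_ne_zero |>.mp (le_antisymm h0 this)
  exact sub_eq_zero.mp (norm_eq_zero.mp this)

end IsTypeIIOneFactor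

end TraceUnique

/-! ### Weak limits of bounded families in a Hilbert space. -/

section WeakLimit

theorem exists_weak_limit {ι E : Type*} [NormedAddCommGroup E] [InnerProductSpace ℂ E]
    [CompleteSpace E] (l : Ultrafilter ι) {v : ι → E} (C : ℝ) (hv : ∀ i, ‖v i‖ ≤ C) :
    ∃ ξ, ∀ η, Tendsto (fun i ↦ ⟪v i, η⟫_ℂ) l (𝓝 ⟪ξ, η⟫_ℂ) := by
  let φ : ι → WeakDual ℂ E := fun i ↦ StrongDual.toWeakDual (InnerProductSpace.toDual ℂ E (v i))
  obtain ⟨f, -, hf⟩ := (WeakDual.isCompact_closedBall (𝕜 := ℂ) (E := E) 0 C).ultrafilter_le_nhds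
    (l.map φ) (by
      rw [Ultrafilter.coe_map, le_principal_iff, mem_map]
      refine Filter.univ_mem' fun i ↦ ?_
      simpa [φ] using hv i)
  refine ⟨(InnerProductSpace.toDual ℂ E).symm (WeakDual.toStrongDual f), fun η ↦ ?_⟩
  rw [InnerProductSpace.toDual_symm_apply]
  have h1 : Tendsto φ l (𝓝 f) := hf
  exact ((WeakDual.eval_continuous η).tendsto f).comp h1

end WeakLimit

/-! ### Independence over `Q` of automorphisms distinct in `Out(Q)`. -/

section Independence

variable {Q : Type*} [CStarAlgebra Q] [PartialOrder Q] [StarOrderedRing Q] {τ : Q →ₚ[ℂ] ℂ}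

namespace IsTypeIIOneFactor

theorem norm_vec_map (hτ : IsTypeIIOneFactor τ) (θ : Q ≃⋆ₐ[ℂ] Q) (x : Q) :
    ‖vec τ (θ x)‖ = ‖vec τ x‖ := by
  rw [← sq_eq_sq₀ (norm_nonneg _) (norm_nonneg _), norm_vec_sq', norm_vec_sq', ← map_star,
    ← map_mul, hτ.trace_map]

theorem norm_left_unitary (hτ : IsTypeIIOneFactor τ) {u : Q} (hu : u ∈ unitary Q) (ξ : τ.GNS) :
    ‖τ.gnsStarAlgHom u ξ‖ = ‖ξ‖ := by
  refine induction_vec ξ (by apply isClosed_eq <;> fun_prop) fun x ↦ ?_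
  rw [leftMul_vec, hτ.norm_vec_unitary_mul ⟨u, hu⟩]

theorem left_mul_apply (x y : Q) (ξ : τ.GNS) :
    τ.gnsStarAlgHom (x * y) ξ = τ.gnsStarAlgHom x (τ.gnsStarAlgHom y ξ) := by
  rw [map_mul]; rfl

theorem left_sum_apply {ι : Type*} (s : Finset ι) (x : ι → Q) (ξ : τ.GNS) :
    τ.gnsStarAlgHom (∑ i ∈ s, x i) ξ = ∑ i ∈ s, τ.gnsStarAlgHom (x i) ξ := by
  rw [map_sum, sum_apply]

theorem left_avg_apply {α : Type*} (w : α →₀ ℝ) (f : α → Q) (ξ : τ.GNS) :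
    τ.gnsStarAlgHom (avg w f) ξ = avg w fun a ↦ τ.gnsStarAlgHom (f a) ξ :=
  map_avg ((ContinuousLinearMap.apply ℂ τ.GNS ξ).toLinearMap ∘ₗ
    (τ.gnsStarAlgHom : Q →⋆ₐ[ℂ] (τ.GNS →L[ℂ] τ.GNS)).toAlgHom.toLinearMap) w f

theorem inner_left_apply (x : Q) (ξ η : τ.GNS) :
    ⟪τ.gnsStarAlgHom x ξ, η⟫_ℂ = ⟪ξ, τ.gnsStarAlgHom (star x) η⟫_ℂ := by
  rw [map_star, ContinuousLinearMap.star_eq_adjoint, ContinuousLinearMap.adjoint_inner_right]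

variable {ι : Type*}

/-- For automorphisms that are pairwise distinct in `Out(Q)`, the averages of `θᵢ(u) θⱼ(u)*`
converge to zero for `i ≠ j`. -/
theorem exists_average_ite [Finite ι] [DecidableEq ι] (hτ : IsTypeIIOneFactor τ)
    {θ : ι → Q ≃⋆ₐ[ℂ] Q} (hθ : Function.Injective fun i ↦ (QuotientGroup.mk (θ i) : Out Q))
    (j : ι) : ∃ w : ℕ → (unitary Q →₀ ℝ), (∀ n, w n ∈ probWeights (unitary Q)) ∧
      ∀ i, Tendsto (fun n ↦ vec τ (avg (w n) fun u ↦ θ i u * star (θ j u))) atTop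
        (𝓝 (vec τ (if i = j then 1 else 0))) := by
  obtain ⟨q, hq, w, hw, hlim⟩ := hτ.exists_average θ (fun _ ↦ θ j) (fun _ ↦ 1)
  refine ⟨w, hw, fun i ↦ ?_⟩
  split_ifs with h
  · subst h
    simp only [coe_unitary_mul_star_self_map, avg_const (hw _)]
    exact tendsto_const_nhds
  · have h0 : q i = 0 := by
      by_contra h0
      exact h (hθ (hτ.mk_eq_mk_of_intertwiner h0 (hq i)))
    simpa [h0] using hlim i

theorem exists_average_ite' [Finite ι] [DecidableEq ι] (hτ : IsTypeIIOneFactor τ)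
    {θ : ι → Q ≃⋆ₐ[ℂ] Q} (hθ : Function.Injective fun i ↦ (QuotientGroup.mk (θ i) : Out Q))
    (j : ι) : ∃ w : ℕ → (unitary Q →₀ ℝ), (∀ n, w n ∈ probWeights (unitary Q)) ∧
      ∀ i, Tendsto (fun n ↦ vec τ (avg (w n) fun u ↦ θ j u * θ i (star (u : Q)))) atTop
        (𝓝 (vec τ (if i = j then 1 else 0))) := by
  obtain ⟨w, hw, hlim⟩ := hτ.exists_average_ite hθ j
  refine ⟨w, hw, fun i ↦ ?_⟩
  have := (hτ.continuous_conj.tendsto _).comp (hlim i)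
  simp only [Function.comp_def, hτ.conj_vec, star_avg, star_mul, star_star, apply_ite star,
    star_one, star_zero] at this
  simpa only [map_star] using this

/-- Automorphisms that are pairwise distinct in `Out(Q)` are linearly independent over `Q`. -/
theorem eq_zero_of_forall_sum_eq_zero [Fintype ι] (hτ : IsTypeIIOneFactor τ)
    {θ : ι → Q ≃⋆ₐ[ℂ] Q} (hθ : Function.Injective fun i ↦ (QuotientGroup.mk (θ i) : Out Q))
    {q : ι → Q} (h : ∀ x, ∑ i, θ i x * q i = 0) (j : ι) : q j = 0 := by
  classical
  obtain ⟨w, hw, hlim⟩ := hτ.exists_average_ite' hθ j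
  -- Take `x = u*` in the relation, multiply on the left by `θ j u` and average; in the limit only
  -- the term `i = j` survives.
  have h1 (n) : ∑ i, (avg (w n) fun u : unitary Q ↦ θ j u * θ i (star (u : Q))) * q i = 0 := by
    simp only [← avg_mul]
    rw [← avg_sum]
    simp only [mul_assoc, ← Finset.mul_sum, h, mul_zero]
    exact avg_const (hw n) 0
  have h2 := tendsto_finsetSum (Finset.univ : Finset ι) fun i _ ↦
    ((rightMul hτ.tracial (q i)).continuous.tendsto _).comp (hlim i)
  simp only [Function.comp_def, rightMul_vec, ← vec_sum, h1, ite_mul, one_mul, zero_mul,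
    Finset.sum_ite_eq', Finset.mem_univ, if_true] at h2
  exact hτ.vec_injective (tendsto_nhds_unique h2 tendsto_const_nhds)

end IsTypeIIOneFactor

end Independence

/-! ### The commutant of the fixed-point algebra `N` on `L²(Q)`. -/

namespace BischHaagerupSetting

variable {Q : Type*} [CStarAlgebra Q] {G : Type*} [Group G]

theorem α_one (S : BischHaagerupSetting Q G) : S.α 1 = 1 := by
  have := S.α_mul_H 1 S.H.one_mem 1 S.H.one_mem
  rw [mul_one] at this
  exact left_eq_mul.mp this

theorem mk_α_injective (S : BischHaagerupSetting Q G) :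
    Function.Injective fun g ↦ (QuotientGroup.mk (S.α g) : Out Q) := fun g g' h ↦ by
  simp only [S.mk_α] at h
  exact S.χ_injective h

theorem α_apply_α_apply (S : BischHaagerupSetting Q G) {h k : G} (hh : h ∈ S.H) (hk : k ∈ S.H)
    (x : Q) : S.α h (S.α k x) = S.α (h * k) x := by
  rw [S.α_mul_H h hh k hk]; rfl

theorem sum_α_mem (S : BischHaagerupSetting Q G) [Fintype S.H] (x : Q) :
    ∑ h : S.H, S.α h x ∈ S.N := by
  intro k hk
  rw [map_sum]
  refine (Finset.sum_congr rfl fun h _ ↦ S.α_apply_α_apply hk h.2 x).trans ?_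
  exact Fintype.sum_equiv (Equiv.mulLeft (⟨k, hk⟩ : S.H)) _ (fun h : S.H ↦ S.α h x) fun _ ↦ rfl

variable [PartialOrder Q] [StarOrderedRing Q] {τ : Q →ₚ[ℂ] ℂ}

open IsTypeIIOneFactor in
/-- The commutant of `N = Q^H` on `L²(Q)` is spanned by right multiplications and the
implementations of the automorphisms `α h`. -/
theorem exists_coeff (S : BischHaagerupSetting Q G) [Fintype S.H] (hτ : IsTypeIIOneFactor τ)
    {T : τ.GNS →L[ℂ] τ.GNS}
    (hT : ∀ n ∈ S.N, ∀ ξ, T (τ.gnsStarAlgHom n ξ) = τ.gnsStarAlgHom n (T ξ)) :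
    ∃ q : S.H → Q, ∀ x, T (vec τ x) = vec τ (∑ h : S.H, S.α h x * q h) := by
  classical
  have hinj : Function.Injective fun h : S.H ↦ (QuotientGroup.mk (S.α h) : Out Q) :=
    S.mk_α_injective.comp Subtype.val_injective
  -- `∑ α_h(x u)` lies in `N`, so `T` commutes with it. With `y = u*` and averaging over `u`, the
  -- argument of `T` tends to `[x]`, since the averages of `α_h(u) u*` tend to zero for `h ≠ 1`.
  have hT' (u x y : Q) : T (vec τ (∑ h : S.H, S.α h x * (S.α h u * y))) =
      ∑ h : S.H, τ.gnsStarAlgHom (S.α h x) (τ.gnsStarAlgHom (S.α h u) (T (vec τ y))) := by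
    simp only [← left_mul_apply, ← map_mul, ← left_sum_apply, ← mul_assoc]
    rw [← hT _ (S.sum_α_mem _), leftMul_vec, Finset.sum_mul]
  obtain ⟨w, hw, hlim⟩ := hτ.exists_average_ite hinj 1
  let v : S.H → ℕ → τ.GNS := fun h n ↦ avg (w n) fun u : unitary Q ↦
    τ.gnsStarAlgHom (S.α h u) (T (vec τ (star (u : Q))))
  have hv (h : S.H) (n) : ‖v h n‖ ≤ ‖T‖ := norm_avg_le (hw n) fun u ↦ by
    rw [hτ.norm_left_unitary (map_unitary_mem _ u)]
    refine (T.le_opNorm _).trans (mul_le_of_le_one_right (norm_nonneg _) ?_)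
    exact (hτ.norm_vec_le _).trans (hτ.norm_unitary_le (star u).2)
  -- The coefficient vectors are only known to be bounded, hence a weak limit along an ultrafilter.
  choose ξ hξ using fun h ↦ exists_weak_limit (hyperfilter ℕ) ‖T‖ (hv h)
  have hTξ (x : Q) : T (vec τ x) = ∑ h : S.H, τ.gnsStarAlgHom (S.α h x) (ξ h) := by
    have e (n) : T (vec τ (∑ h : S.H, S.α h x *
        avg (w n) fun u : unitary Q ↦ S.α h u * star (S.α (1 : S.H) u))) =
        ∑ h : S.H, τ.gnsStarAlgHom (S.α h x) (v h n) := by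
      have e1 : ∑ h : S.H, τ.gnsStarAlgHom (S.α h x) (v h n) =
          avg (w n) fun u : unitary Q ↦ ∑ h : S.H, τ.gnsStarAlgHom (S.α h x)
            (τ.gnsStarAlgHom (S.α h u) (T (vec τ (star (u : Q))))) := by
        rw [avg_sum]
        exact Finset.sum_congr rfl fun h _ ↦
          map_avg (τ.gnsStarAlgHom (S.α h x)).toLinearMap (w n) _
      simp only [← mul_avg]
      rw [← avg_sum, vec_avg, e1]
      refine (map_avg T.toLinearMap (w n) _).trans ?_
      congr 1
      ext1 u
      rw [← hT', OneMemClass.coe_one, S.α_one]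
      rfl
    refine ext_inner_right ℂ fun η ↦ ?_
    have h1 : Tendsto (fun n ↦ ⟪∑ h : S.H, τ.gnsStarAlgHom (S.α h x) (v h n), η⟫_ℂ)
        (hyperfilter ℕ : Filter ℕ) (𝓝 ⟪∑ h : S.H, τ.gnsStarAlgHom (S.α h x) (ξ h), η⟫_ℂ) := by
      simp only [sum_inner, inner_left_apply]
      exact tendsto_finsetSum _ fun h _ ↦ hξ h _
    have h2 := tendsto_finsetSum (Finset.univ : Finset S.H) fun h _ ↦
      ((τ.gnsStarAlgHom (S.α h x)).continuous.tendsto _).comp (hlim h)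
    simp only [Function.comp_def, leftMul_vec, ← vec_sum, mul_ite, mul_one, mul_zero,
      Finset.sum_ite_eq', Finset.mem_univ, if_true] at h2
    rw [OneMemClass.coe_one, S.α_one] at h2
    have h3 := ((T.continuous.tendsto _).comp h2).inner (𝕜 := ℂ) (tendsto_const_nhds (x := η))
    refine tendsto_nhds_unique (h3.mono_left Nat.hyperfilter_le_atTop) (h1.congr fun n ↦ ?_)
    rw [← e, OneMemClass.coe_one, S.α_one]
    rfl
  -- A second averaging isolates one coefficient: the averages of `α_j(u) T[u* y]` have norm at most
  -- `‖T‖ ‖[y]‖` and tend to `α_j(y) ξ_j`. Trace preservation turns this into the bound for a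
  -- bounded vector.
  have hbd (j : S.H) : ∃ q, ξ j = vec τ q := by
    obtain ⟨w', hw', hlim'⟩ := hτ.exists_average_ite' hinj j
    refine hτ.exists_eq_vec_of_left ‖T‖ fun y ↦ ?_
    obtain ⟨y, rfl⟩ := EquivLike.surjective (S.α j) y
    change ‖τ.gnsStarAlgHom (S.α j y) (ξ j)‖ ≤ ‖T‖ * ‖vec τ (S.α j y)‖
    rw [hτ.norm_vec_map]
    have e (n) : (avg (w' n) fun u : unitary Q ↦
          τ.gnsStarAlgHom (S.α j u) (T (vec τ (star (u : Q) * y)))) =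
        ∑ h : S.H, τ.gnsStarAlgHom (avg (w' n) fun u : unitary Q ↦ S.α j u * S.α h (star (u : Q)))
          (τ.gnsStarAlgHom (S.α h y) (ξ h)) := by
      simp only [left_avg_apply, hTξ, map_sum, map_mul]
      rw [avg_sum]
      rfl
    have h1 : Tendsto (fun n ↦ avg (w' n) fun u : unitary Q ↦
        τ.gnsStarAlgHom (S.α j u) (T (vec τ (star (u : Q) * y)))) atTop
        (𝓝 (τ.gnsStarAlgHom (S.α j y) (ξ j))) := by
      simp only [e]
      have := tendsto_finsetSum (Finset.univ : Finset S.H) fun h _ ↦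
        hτ.tendsto_left_apply 1 (fun n ↦ norm_avg_le (hw' n) fun u ↦ by
          refine (norm_mul_le _ _).trans (mul_le_one₀ ?_ (norm_nonneg _) ?_)
          · exact hτ.norm_unitary_le (map_unitary_mem _ u)
          · exact hτ.norm_unitary_le (map_unitary_mem _ (star u))) (hlim' h)
          (τ.gnsStarAlgHom (S.α h y) (ξ h))
      refine this.trans (le_of_eq ?_)
      congr 1
      rw [Finset.sum_eq_single j]
      · simp only [if_true, _root_.map_one]; rfl
      · intro h _ hj
        simp only [hj, if_false, map_zero]; rfl
      · simp
    refine le_of_tendsto h1.norm (.of_forall fun n ↦ norm_avg_le (hw' n) fun u ↦ ?_)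
    rw [hτ.norm_left_unitary (map_unitary_mem _ u)]
    refine (T.le_opNorm _).trans (mul_le_mul_of_nonneg_left (le_of_eq ?_) (norm_nonneg _))
    exact hτ.norm_vec_unitary_mul (star u) y
  choose q hq using hbd
  refine ⟨q, fun x ↦ ?_⟩
  simp only [hTξ, hq, leftMul_vec, vec_sum]

end BischHaagerupSetting

theorem IsTypeIIOneFactor.exists_extension_mul_map {Q : Type*} [CStarAlgebra Q] [PartialOrder Q]
    [StarOrderedRing Q] {τ : Q →ₚ[ℂ] ℂ} (hτ : IsTypeIIOneFactor τ) (θ : Q ≃⋆ₐ[ℂ] Q) (a b : Q) :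
    ∃ T : τ.GNS →L[ℂ] τ.GNS, ∀ x, T (vec τ x) = vec τ (a * θ x * b) := by
  refine exists_extension (vecₗ τ ∘ₗ LinearMap.mulRight ℂ b ∘ₗ LinearMap.mulLeft ℂ a ∘ₗ
    (θ : Q →ₗ[ℂ] Q)) (‖a‖ * ‖b‖) fun x ↦ ?_
  change ‖vec τ (a * θ x * b)‖ ≤ _
  refine (hτ.norm_vec_mul_le' _ _).trans ?_
  have := hτ.norm_vec_mul_le a (θ x)
  rw [hτ.norm_vec_map] at this
  calc _ ≤ ‖a‖ * ‖vec τ x‖ * ‖b‖ := mul_le_mul_of_nonneg_right this (norm_nonneg _)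
    _ = _ := by ring

/-! ### Intertwiners on `N` and morphisms between the bimodules `X_g`. -/

namespace BischHaagerupSetting

variable {Q : Type*} [CStarAlgebra Q] {G : Type*} [Group G]

/-- The unitary `u(h, g₁) u(g₂, k)*`. -/
noncomputable def v (S : BischHaagerupSetting Q G) (g₁ g₂ h k : G) : unitary Q :=
  S.u h g₁ * star (S.u g₂ k)

theorem α_apply_eq (S : BischHaagerupSetting Q G) (g g' : G) (x : Q) :
    S.α g (S.α g' x) = S.u g g' * S.α (g * g') x * star (S.u g g' : Q) :=
  congrArg (fun f : Q ≃⋆ₐ[ℂ] Q ↦ f x) (S.α_mul g g')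

/-- Both composites are inner perturbations of the same `α (g₂ * k)`, by `u h g₁` and by `u g₂ k`.
-/
theorem α_mul_v (S : BischHaagerupSetting Q G) {g₁ g₂ h k : G} (e : h * g₁ = g₂ * k) (x : Q) :
    S.α h (S.α g₁ x) * S.v g₁ g₂ h k = S.v g₁ g₂ h k * S.α g₂ (S.α k x) := by
  have h1 : star (S.u h g₁ : Q) * S.u h g₁ = 1 := Unitary.coe_star_mul_self _
  have h2 : star (S.u g₂ k : Q) * S.u g₂ k = 1 := Unitary.coe_star_mul_self _
  simp only [S.α_apply_eq, v, e, Submonoid.coe_mul, Unitary.coe_star]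
  calc _ = (S.u h g₁ : Q) * S.α (g₂ * k) x * (star (S.u h g₁ : Q) * S.u h g₁) *
        star (S.u g₂ k : Q) := by simp only [mul_assoc]
    _ = (S.u h g₁ : Q) * (star (S.u g₂ k : Q) * S.u g₂ k) * S.α (g₂ * k) x *
        star (S.u g₂ k : Q) := by rw [h1, h2, mul_one, mul_one]
    _ = _ := by simp only [mul_assoc]

variable [PartialOrder Q] [StarOrderedRing Q] {τ : Q →ₚ[ℂ] ℂ}

/-- Intertwiners on `N = Q^H` between the identity and an automorphism `β` of `Q` extend to
intertwiners on `Q` between some `α k`, `k ∈ H`, and `β`. -/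
theorem exists_intertwiner (S : BischHaagerupSetting Q G) (hτ : IsTypeIIOneFactor τ)
    (β : Q ≃⋆ₐ[ℂ] Q) {a : Q} (ha : a ≠ 0) (h : ∀ n ∈ S.N, n * a = a * β n) :
    ∃ k ∈ S.H, ∀ y, S.α k y * a = a * β y := by
  have := S.finite_H
  have := Fintype.ofFinite S.H
  obtain ⟨T, hT⟩ := hτ.exists_extension_mul_map β a 1
  simp only [mul_one] at hT
  obtain ⟨c, hc⟩ := S.exists_coeff hτ (T := T) fun n hn ξ ↦ by
    refine induction_vec ξ (by apply isClosed_eq <;> fun_prop) fun x ↦ ?_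
    rw [leftMul_vec, hT, hT, leftMul_vec, map_mul, ← mul_assoc, ← mul_assoc, h n hn]
  have hsum (x : Q) : a * β x = ∑ k : S.H, S.α k x * c k :=
    hτ.vec_injective ((hT x).symm.trans (hc x))
  -- For each unitary `u`, the sum over `k` of `α_k(u) c_k β(u)*` is `a β(u) β(u)* = a`, so `a` is
  -- the sum of the limits `q k`. Two nonzero `q k` would identify distinct elements of `H` in
  -- `Out(Q)`.
  obtain ⟨q, hq, w, hw, hlim⟩ := hτ.exists_average (fun k : S.H ↦ S.α k) (fun _ ↦ β) c
  have hqa : a = ∑ k, q k := by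
    have h1 := tendsto_finsetSum (Finset.univ : Finset S.H) fun k _ ↦ hlim k
    have e (n) : ∑ k : S.H, avg (w n) (fun u : unitary Q ↦ S.α k u * c k * star (β u)) = a := by
      rw [← avg_sum]
      simp only [← Finset.sum_mul, ← hsum]
      simp only [mul_assoc, coe_unitary_mul_star_self_map, mul_one]
      exact avg_const (hw n) a
    simp only [← vec_sum, e] at h1
    exact hτ.vec_injective (tendsto_nhds_unique tendsto_const_nhds h1)
  obtain ⟨k, hk⟩ : ∃ k, q k ≠ 0 := by
    by_contra! h0
    exact ha (by rw [hqa, Finset.sum_eq_zero fun k _ ↦ h0 k])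
  have hqk : a = q k := by
    rw [hqa, Finset.sum_eq_single k (fun k' _ hne ↦ ?_) (by simp)]
    by_contra h0
    exact hne (Subtype.ext (S.mk_α_injective ((hτ.mk_eq_mk_of_intertwiner h0 (hq k')).trans
      (hτ.mk_eq_mk_of_intertwiner hk (hq k)).symm)))
  exact ⟨k, k.2, fun y ↦ by rw [hqk, hq]⟩

/-- Pulling back by `θ = α_h α_{g₁}` puts the relation in the form treated by `exists_intertwiner`.
On all of `Q`, both `q` and `v` then intertwine the same two automorphisms, so `v* q` is central,
hence scalar. -/
theorem coeff_eq_zero_or (S : BischHaagerupSetting Q G) (hτ : IsTypeIIOneFactor τ) {g₁ g₂ h : G}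
    {q : Q} (hq : ∀ n ∈ S.N, S.α h (S.α g₁ n) * q = q * S.α g₂ n) :
    q = 0 ∨ ∃ k ∈ S.H, h * g₁ = g₂ * k ∧ ∃ c : ℂ, q = c • (S.v g₁ g₂ h k : Q) := by
  refine or_iff_not_imp_left.mpr fun hq0 ↦ ?_
  set θ : Q ≃⋆ₐ[ℂ] Q := S.α h * S.α g₁ with hθ
  have hθθ (x : Q) : θ (θ.symm x) = x := θ.apply_symm_apply x
  obtain ⟨k, hk, hkq⟩ := S.exists_intertwiner hτ ((S.α g₂).trans θ.symm) (a := θ.symm q)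
    (fun h0 ↦ hq0 (by rw [← hθθ q, h0, map_zero])) fun n hn ↦ by
      refine θ.injective ?_
      change θ (n * θ.symm q) = θ (θ.symm q * θ.symm (S.α g₂ n))
      rw [map_mul, map_mul, hθθ, hθθ]
      exact hq n hn
  have hkq' (y : Q) : (θ * S.α k) y * q = q * S.α g₂ y := by
    have := congrArg θ (hkq y)
    change θ (S.α k y * θ.symm q) = θ (θ.symm q * θ.symm (S.α g₂ y)) at this
    rwa [map_mul, map_mul, hθθ, hθθ] at this
  have hmk := hτ.mk_eq_mk_of_intertwiner hq0 hkq'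
  rw [hθ, QuotientGroup.mk_mul, QuotientGroup.mk_mul, S.mk_α, S.mk_α, S.mk_α, S.mk_α, ← map_mul,
    ← map_mul] at hmk
  have hg : h * g₁ = g₂ * k⁻¹ := eq_mul_inv_of_mul_eq (S.χ_injective hmk)
  refine ⟨k⁻¹, S.H.inv_mem hk, hg, ?_⟩
  set v : unitary Q := S.v g₁ g₂ h k⁻¹ with hv
  have hv1 : star (v : Q) * v = 1 := Unitary.coe_star_mul_self v
  have hv2 : (v : Q) * star (v : Q) = 1 := (Unitary.mem_iff.mp v.2).2
  have hθq (x : Q) : θ x * q = q * S.α g₂ (S.α k⁻¹ x) := by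
    rw [← hkq']
    change _ = θ (S.α k (S.α k⁻¹ x)) * q
    rw [S.α_apply_α_apply hk (S.H.inv_mem hk), mul_inv_cancel, S.α_one]
    rfl
  have hvθ (x : Q) : star (v : Q) * θ x = S.α g₂ (S.α k⁻¹ x) * star (v : Q) := by
    calc star (v : Q) * θ x = star (v : Q) * (θ x * v) * star (v : Q) := by
          rw [mul_assoc, mul_assoc, hv2, mul_one]
      _ = star (v : Q) * (v * S.α g₂ (S.α k⁻¹ x)) * star (v : Q) := by
          rw [show θ x * v = v * S.α g₂ (S.α k⁻¹ x) from S.α_mul_v hg x]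
      _ = _ := by rw [← mul_assoc, hv1, one_mul]
  obtain ⟨c, hc⟩ := hτ.factor (star (v : Q) * q) fun x ↦ by
    obtain ⟨y, rfl⟩ := EquivLike.surjective (S.α g₂ * S.α k⁻¹) x
    change star (v : Q) * q * S.α g₂ (S.α k⁻¹ y) = S.α g₂ (S.α k⁻¹ y) * (star (v : Q) * q)
    rw [mul_assoc, ← hθq, ← mul_assoc, hvθ, mul_assoc]
  refine ⟨c, ?_⟩
  rw [Algebra.algebraMap_eq_smul_one] at hc
  rw [← one_mul q, ← hv2, mul_assoc, hc, mul_smul_comm, mul_one]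

theorem exists_coeff_of_mem_hom (S : BischHaagerupSetting Q G) [Fintype S.H]
    (hτ : IsTypeIIOneFactor τ) {g₁ g₂ : G} {T : τ.GNS →L[ℂ] τ.GNS}
    (hT : T ∈ (S.X hτ g₁).Hom (S.X hτ g₂)) :
    ∃ q : S.H → Q, (∀ x, T (vec τ x) = vec τ (∑ h : S.H, S.α h x * q h)) ∧
      ∀ h : S.H, q h = 0 ∨ ∃ k ∈ S.H, (h : G) * g₁ = g₂ * k ∧
        ∃ c : ℂ, q h = c • (S.v g₁ g₂ h k : Q) := by
  obtain ⟨q, hq⟩ := S.exists_coeff hτ fun n hn ξ ↦ hT.1 ⟨n, hn⟩ ξ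
  refine ⟨q, hq, fun h ↦ S.coeff_eq_zero_or hτ fun n hn ↦ ?_⟩
  have hinj : Function.Injective fun h : S.H ↦ (QuotientGroup.mk (S.α h) : Out Q) :=
    S.mk_α_injective.comp Subtype.val_injective
  -- Right `N`-linearity at `[x]` says that the coefficient differences, weighted by `α_h(x)`, sum
  -- to zero for every `x`; independence makes each of them vanish.
  refine sub_eq_zero.mp (hτ.eq_zero_of_forall_sum_eq_zero hinj
    (q := fun h : S.H ↦ S.α h (S.α g₁ n) * q h - q h * S.α g₂ n) (fun x ↦ ?_) h)
  have h1 := hT.2 ⟨n, hn⟩ (vec τ x)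
  rw [X_right_vec, hq, hq, X_right_vec] at h1
  have h2 := hτ.vec_injective h1
  simp only [mul_sub, Finset.sum_sub_distrib, sub_eq_zero]
  simpa only [map_mul, Finset.sum_mul, mul_assoc] using h2

theorem exists_mem_hom (S : BischHaagerupSetting Q G) (hτ : IsTypeIIOneFactor τ) {g₁ g₂ h k : G}
    (hh : h ∈ S.H) (hk : k ∈ S.H) (e : h * g₁ = g₂ * k) :
    ∃ T : (S.X hτ g₁).Hom (S.X hτ g₂), ∀ x, (T : τ.GNS →L[ℂ] τ.GNS) (vec τ x) =
      vec τ (S.α h x * S.v g₁ g₂ h k) := by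
  obtain ⟨T, hT⟩ := hτ.exists_extension_mul_map (S.α h) 1 (S.v g₁ g₂ h k : Q)
  simp only [one_mul] at hT
  refine ⟨⟨T, fun n ξ ↦ ?_, fun n ξ ↦ ?_⟩, hT⟩
  · refine induction_vec ξ (by apply isClosed_eq <;> fun_prop) fun x ↦ ?_
    rw [X_left_vec, hT, hT, X_left_vec, map_mul, n.2 h hh, mul_assoc]
  · refine induction_vec ξ (by apply isClosed_eq <;> fun_prop) fun x ↦ ?_
    rw [X_right_vec, hT, hT, X_right_vec, map_mul, mul_assoc, mul_assoc, S.α_mul_v e, n.2 k hk]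

end BischHaagerupSetting

/-! ### The morphism spaces: vanishing and basis. -/

theorem proposition4p2
    {Q : Type*} [CStarAlgebra Q] [PartialOrder Q] [StarOrderedRing Q]
    {τ : Q →ₚ[ℂ] ℂ} (hτ : IsTypeIIOneFactor τ)
    {G : Type*} [Group G] (S : BischHaagerupSetting Q G) (g₁ g₂ : G) :
    (DoubleCoset.doubleCoset g₁ (S.H : Set G) (S.H : Set G) ≠
        DoubleCoset.doubleCoset g₂ (S.H : Set G) (S.H : Set G) →
      (S.X hτ g₁).Hom (S.X hτ g₂) = ⊥) ∧
    (DoubleCoset.doubleCoset g₁ (S.H : Set G) (S.H : Set G) =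
        DoubleCoset.doubleCoset g₂ (S.H : Set G) (S.H : Set G) →
      ∃ b : Module.Basis {p : G × G // p.1 ∈ S.H ∧ p.2 ∈ S.H ∧ p.1 * g₁ = g₂ * p.2} ℂ
          ((S.X hτ g₁).Hom (S.X hτ g₂)),
        ∀ (p : {p : G × G // p.1 ∈ S.H ∧ p.2 ∈ S.H ∧ p.1 * g₁ = g₂ * p.2}) (x : Q),
          (b p : τ.GNS →L[ℂ] τ.GNS) (vec τ x) =
            vec τ (S.α p.1.1 x * (S.u p.1.1 g₁ : Q) * star (S.u g₂ p.1.2 : Q))) := by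
  have := S.finite_H
  have := Fintype.ofFinite S.H
  constructor
  · intro hne
    refine (Submodule.eq_bot_iff _).mpr fun T hT ↦ ?_
    obtain ⟨q, hq, hq0⟩ := S.exists_coeff_of_mem_hom hτ hT
    refine ext_vec fun x ↦ ?_
    rw [hq, Finset.sum_eq_zero fun h _ ↦ ?_, vec_zero]
    · rfl
    · rcases hq0 h with h0 | ⟨k, hk, e, -⟩
      · rw [h0, mul_zero]
      · refine absurd ?_ hne
        refine (DoubleCoset.doubleCoset_eq_of_mem ?_).symm
        rw [DoubleCoset.mem_doubleCoset]
        exact ⟨h, h.2, k⁻¹, S.H.inv_mem hk, eq_mul_inv_of_mul_eq e.symm⟩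
  · intro _
    set P := {p : G × G // p.1 ∈ S.H ∧ p.2 ∈ S.H ∧ p.1 * g₁ = g₂ * p.2}
    choose B hB using fun p : P ↦ S.exists_mem_hom hτ p.2.1 p.2.2.1 p.2.2.2
    -- A pair is determined by its first entry, so distinct pairs involve automorphisms distinct in
    -- `Out(Q)`; independence of the `B p` follows.
    have hfst : Function.Injective fun p : P ↦ p.1.1 := fun p p' h ↦ by
      have h : p.1.1 = p'.1.1 := h
      refine Subtype.ext (Prod.ext h (mul_left_cancel (a := g₂) ?_))
      rw [← p.2.2.2, ← p'.2.2.2, h]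
    have : Finite P := Finite.of_injective (fun p : P ↦ (⟨p.1.1, p.2.1⟩ : S.H)) fun p p' h ↦
      hfst (congrArg Subtype.val h)
    have := Fintype.ofFinite P
    have hli : LinearIndependent ℂ B := by
      refine Fintype.linearIndependent_iff.mpr fun c hc p ↦ ?_
      have hv := hτ.eq_zero_of_forall_sum_eq_zero (θ := fun p : P ↦ S.α p.1.1)
        (S.mk_α_injective.comp hfst) (q := fun p ↦ c p • (S.v g₁ g₂ p.1.1 p.1.2 : Q)) (fun x ↦ by
          refine hτ.vec_injective ?_
          have := congrArg (fun T : (S.X hτ g₁).Hom (S.X hτ g₂) ↦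
            (T : τ.GNS →L[ℂ] τ.GNS) (vec τ x)) hc
          simp only [Submodule.coe_sum, Submodule.coe_smul, sum_apply,
            smul_apply, hB, Submodule.coe_zero,
            zero_apply] at this
          simpa only [vec_sum, mul_smul_comm, vec_smul, vec_zero] using this) p
      refine (smul_eq_zero.mp hv).resolve_right fun h0 ↦ ?_
      have h1 : star (S.v g₁ g₂ p.1.1 p.1.2 : Q) * S.v g₁ g₂ p.1.1 p.1.2 = 1 :=
        Unitary.coe_star_mul_self _
      have := hτ.nontrivial
      rw [h0, mul_zero] at h1
      exact zero_ne_one h1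
    have hsp : ⊤ ≤ Submodule.span ℂ (Set.range B) := by
      rintro ⟨T, hT⟩ -
      obtain ⟨q, hq, hq0⟩ := S.exists_coeff_of_mem_hom hτ hT
      have hex (h : S.H) : ∃ A ∈ Submodule.span ℂ (Set.range B),
          ∀ x, (A : τ.GNS →L[ℂ] τ.GNS) (vec τ x) = vec τ (S.α h x * q h) := by
        rcases hq0 h with h0 | ⟨k, hk, e, c, hc⟩
        · exact ⟨0, zero_mem _, fun x ↦ by rw [h0, mul_zero, vec_zero]; rfl⟩
        · refine ⟨c • B ⟨(h, k), h.2, hk, e⟩,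
            Submodule.smul_mem _ _ (Submodule.subset_span ⟨_, rfl⟩), fun x ↦ ?_⟩
          rw [hc, mul_smul_comm, vec_smul, ← hB ⟨(h, k), h.2, hk, e⟩]
          rfl
      choose A hA hAx using hex
      have : (⟨T, hT⟩ : (S.X hτ g₁).Hom (S.X hτ g₂)) = ∑ h, A h := by
        refine Subtype.ext (ext_vec fun x ↦ ?_)
        simp only [Submodule.coe_sum, sum_apply, hAx, hq, vec_sum]
      rw [this]
      exact sum_mem fun h _ ↦ hA h
    refine ⟨Module.Basis.mk hli hsp, fun p x ↦ ?_⟩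
    rw [Module.Basis.mk_apply, hB, mul_assoc]
    rfl
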